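/- There is an absolute constant $c>0$ such that the following holds. Let $H$ be a finite 3-graph (a 3-uniform hypergraph, without repeated edges) with $m\ge 2$ edges. Then $H$ has a 3-cut of size at least $$\frac{2}{9}m+c\,\frac{m^{3/5}}{(\log m)^2},$$ that is, the vertex set of $H$ can be partitioned into three parts $V_1,V_2,V_3$ such that at least $\frac{2}{9}m+c\,\frac{m^{3/5}}{(\log m)^2}$ edges of $H$ have at least one vertex in each of $V_1,V_2,V_3$. -/

import Mathlib

namespace Hypergraph

/-- `H` is `r`-uniform, that is, an `r`-graph: every edge has exactly `r` vertices. (The edges of a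
`Hypergraph` form a set, so there are no repeated edges.) -/
def IsUniform {α : Type*} (H : Hypergraph α) (r : ℕ) : Prop :=
  ∀ e ∈ H.edgeSet, e.encard = r

/-- `P 0, …, P (k - 1)` is a partition of the vertex set of `H` into `k` labelled parts. As usual
for cuts, a part may be empty (but then no edge is cut). -/
def IsVertexPartition {α : Type*} (H : Hypergraph α) {k : ℕ} (P : Fin k → Set α) : Prop :=
  (∀ i j, i ≠ j → Disjoint (P i) (P j)) ∧ ⋃ i, P i = H.vertexSet

/-- The edges of the `k`-cut given by the parts `P`: those with at least one vertex in every
part. -/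
def cutEdges {α : Type*} (H : Hypergraph α) {k : ℕ} (P : Fin k → Set α) : Set (Set α) :=
  {e | e ∈ H.edgeSet ∧ ∀ i, (e ∩ P i).Nonempty}

end Hypergraph

/-!
Write `h v a b` for the indicator function of the edges on ordered triples of vertices, and colour
the vertices at random with three colours. The vertices of colour `2` induce a multigraph on the
remaining vertices, whose adjacency matrix is `linkMatrix h f`; an edge of the 3-graph survives in it
with probability `4/9`, and a 2-cut of the multigraph is a 3-cut of the 3-graph. A random 2-cut gives
`2m/9`, so everything is about the expected surplus of the max-cut of this random multigraph.

*Surplus from semidefinite matrices.* A positive semidefinite matrix `X` with diagonal at most one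
can be rounded to signs `x` with `xᵀ A x ≤ ⟨A, X⟩ / τ²` up to an error that is Gaussian in `τ`
(`exists_sign_le_of_posSemidef`). With `τ²` of order `log m` the error is negligible. Hence any family
`X f` of such matrices yields a surplus of order `-𝔼 ⟨linkMatrix h f, X f⟩ / log m`
(`exists_rainbowCount_ge`).

*Choice of the matrices.* Put `s = m^{1/5}`; the goal is a correlation of order `-s³`. The mean of
the link matrix is a multiple of the codegree matrix `B`. By `sum_triple_le` one of the following
holds.
* A constant fraction of the edges contains a pair of codegree more than `s`. Then the Frobenius norm
  of `B` is at least of order `√(s m) = s³`, and `X = (1 - B / ‖B‖) / 2` works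
  (`exists_posSemidef_frobenius`).
* A constant fraction of the edges has two vertices of degree at least of order `s³`. There are at
  most of order `m / s³` such vertices, so `B` has average row sum at least of order `s³` on them, and
  the projection orthogonal to their indicator vector works (`exists_posSemidef_indicator`).
* A constant fraction of the edges has low codegrees and two vertices of low degree. Here the random
  part of the link matrix is used: exchanging the colours `1` and `2` changes the sign of
  `signedLink g f`, where `g` is the indicator function of the good triples. Its second moment is of
  order `m`, and counting closed walks of length four bounds its fourth moment by a multiple of
  `s · s³ · m` (`expect_sum_signedLink_sq_sq_le`). So it behaves like a matrix of norm `K = O(s²)`,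
  and cutting it off at height `K` by the odd function `2 y / (1 + y²)` gives matrices with
  correlation of order `m / K = s³` (`exists_posSemidef_random`).
-/

namespace HypergraphCut

open scoped BigOperators

/-! ### Rounding semidefinite matrices to signs -/

theorem expect_prod_apply {ι κ : Type*} [Fintype ι] [DecidableEq ι] [Fintype κ] (φ : ι → κ → ℝ) :
    𝔼 f : ι → κ, ∏ i, φ i (f i) = ∏ i, 𝔼 k, φ i k := by
  simp only [Fintype.expect_eq_sum_div_card, Finset.prod_div_distrib, Finset.prod_const,
    Finset.card_univ, Fintype.card_fun, Nat.cast_pow]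
  rw [Finset.prod_univ_sum, Fintype.piFinset_univ]

/-- The sign `±1` encoded by a Boolean. -/
def boolSign (b : Bool) : ℝ := if b then 1 else -1

theorem boolSign_mul_self (b : Bool) : boolSign b * boolSign b = 1 := by
  cases b <;> simp [boolSign]

theorem boolSign_not (b : Bool) : boolSign (!b) = -boolSign b := by
  cases b <;> simp [boolSign]

/-- An average over functions vanishes if the summand changes sign under an involution of the
values taken at one point. -/
theorem expect_eq_zero_of_update {ι κ : Type*} [Fintype ι] [DecidableEq ι] [Fintype κ]
    (s : κ → κ) (hs : Function.Involutive s) (i : ι) (F : (ι → κ) → ℝ)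
    (hF : ∀ f, F (Function.update f i (s (f i))) = -F f) : 𝔼 f, F f = 0 := by
  have hinv : Function.Involutive fun f : ι → κ => Function.update f i (s (f i)) := by
    intro f
    simp [hs (f i)]
  have h := Fintype.expect_equiv (hinv.toPerm _)
    (fun f => F (Function.update f i (s (f i)))) F fun f => rfl
  simp only [hF, Finset.expect_neg_distrib] at h
  linarith

/-- The Rademacher sum `∑ σ k q k` for the sign pattern `σ`. -/
def signSum {ι : Type*} [Fintype ι] (q : ι → ℝ) (σ : ι → Bool) : ℝ := ∑ k, boolSign (σ k) * q k

theorem expect_boolSign_mul {ι : Type*} [Fintype ι] [DecidableEq ι] (k l : ι) :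
    𝔼 σ : ι → Bool, boolSign (σ k) * boolSign (σ l) = if k = l then 1 else 0 := by
  split_ifs with h
  · subst h
    simp only [boolSign_mul_self]
    exact Fintype.expect_const 1
  · refine expect_eq_zero_of_update not Bool.not_not k _ fun f => ?_
    simp [Function.update_of_ne (Ne.symm h), boolSign_not]

theorem expect_signSum_mul {ι : Type*} [Fintype ι] [DecidableEq ι] (p q : ι → ℝ) :
    𝔼 σ, signSum p σ * signSum q σ = ∑ k, p k * q k := by
  have h1 : ∀ σ : ι → Bool, signSum p σ * signSum q σ =
      ∑ k, ∑ l, (p k * q l) * (boolSign (σ k) * boolSign (σ l)) := by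
    intro σ
    rw [signSum, signSum, Finset.sum_mul_sum]
    exact Finset.sum_congr rfl fun k _ => Finset.sum_congr rfl fun l _ => by ring
  simp only [h1, Finset.expect_sum_comm, ← Finset.mul_expect, expect_boolSign_mul]
  simp

theorem expect_exp_signSum_le {ι : Type*} [Fintype ι] [DecidableEq ι] (q : ι → ℝ) (s : ℝ) :
    𝔼 σ, Real.exp (s * signSum q σ) ≤ Real.exp (s ^ 2 / 2 * ∑ k, q k ^ 2) := by
  have h1 : ∀ σ : ι → Bool, Real.exp (s * signSum q σ) =
      ∏ k, Real.exp (boolSign (σ k) * (s * q k)) := by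
    intro σ
    rw [← Real.exp_sum, signSum, Finset.mul_sum]
    congr 1
    exact Finset.sum_congr rfl fun k _ => by ring
  simp only [h1]
  rw [expect_prod_apply (fun k b => Real.exp (boolSign b * (s * q k))), Finset.mul_sum,
    Real.exp_sum]
  refine Finset.prod_le_prod (fun k _ => Finset.expect_nonneg fun b _ => (Real.exp_pos _).le)
    fun k _ => ?_
  have h2 : 𝔼 b : Bool, Real.exp (boolSign b * (s * q k)) = Real.cosh (s * q k) := by
    rw [Fintype.expect_eq_sum_div_card, Real.cosh_eq]
    simp [boolSign]
  rw [h2]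
  refine (Real.cosh_le_exp_half_sq _).trans (le_of_eq ?_)
  congr 1
  ring

/-- Truncation of a real number to the interval `[-τ, τ]`. -/
def clamp (τ y : ℝ) : ℝ := max (-τ) (min τ y)

theorem abs_clamp_le {τ : ℝ} (hτ : 0 < τ) (y : ℝ) : |clamp τ y| ≤ τ := by
  rw [clamp, abs_le]
  exact ⟨le_max_left _ _, max_le (by linarith) (min_le_left _ _)⟩

theorem abs_clamp_le_abs {τ : ℝ} (hτ : 0 < τ) (y : ℝ) : |clamp τ y| ≤ |y| := by
  rw [clamp, abs_le]
  constructor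
  · exact le_max_of_le_right (le_min (by linarith [abs_nonneg y]) (neg_abs_le y))
  · exact max_le (by linarith [abs_nonneg y]) ((min_le_right _ _).trans (le_abs_self y))

theorem sub_clamp_sq_le {τ : ℝ} (hτ : 0 < τ) (y : ℝ) :
    (y - clamp τ y) ^ 2 ≤
      2 / τ ^ 2 * Real.exp (-τ ^ 2) * (Real.exp (τ * y) + Real.exp (-τ * y)) := by
  have key : ∀ w : ℝ, 0 ≤ w → w ^ 2 ≤ 2 / τ ^ 2 * Real.exp (τ * w) := by
    intro w hw
    have h := Real.quadratic_le_exp_of_nonneg (mul_nonneg hτ.le hw)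
    rw [div_mul_eq_mul_div, le_div_iff₀ (by positivity)]
    nlinarith [mul_nonneg hτ.le hw]
  have e1 : ∀ w, Real.exp (-τ ^ 2) * Real.exp (τ * w) = Real.exp (τ * (w - τ)) := by
    intro w
    rw [← Real.exp_add]
    congr 1
    ring
  have hp : 0 ≤ 2 / τ ^ 2 := by positivity
  have e2 : 2 / τ ^ 2 * Real.exp (-τ ^ 2) * (Real.exp (τ * y) + Real.exp (-τ * y)) =
      2 / τ ^ 2 * Real.exp (τ * (y - τ)) + 2 / τ ^ 2 * Real.exp (τ * (-y - τ)) := by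
    rw [← e1, ← e1]
    ring_nf
  have p1 : 0 ≤ 2 / τ ^ 2 * Real.exp (τ * (y - τ)) := by positivity
  have p2 : 0 ≤ 2 / τ ^ 2 * Real.exp (τ * (-y - τ)) := by positivity
  rw [e2, clamp]
  rcases le_total τ y with h | h
  · rw [min_eq_left h, max_eq_right (by linarith)]
    linarith [key (y - τ) (by linarith)]
  · rw [min_eq_right h]
    rcases le_total (-τ) y with h' | h'
    · rw [max_eq_right h', sub_self]
      nlinarith
    · rw [max_eq_left h']
      have := key (-y - τ) (by linarith)
      nlinarith

theorem expect_sub_clamp_sq_le {ι : Type*} [Fintype ι] [DecidableEq ι] {τ : ℝ} (hτ : 0 < τ)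
    (q : ι → ℝ) (hq : ∑ k, q k ^ 2 ≤ 1) :
    𝔼 σ, (signSum q σ - clamp τ (signSum q σ)) ^ 2 ≤ 4 / τ ^ 2 * Real.exp (-τ ^ 2 / 2) := by
  have h1 : ∀ s : ℝ, s ^ 2 = τ ^ 2 → 𝔼 σ, Real.exp (s * signSum q σ) ≤ Real.exp (τ ^ 2 / 2) := by
    intro s hs
    refine (expect_exp_signSum_le q s).trans (Real.exp_le_exp.2 ?_)
    rw [hs]
    nlinarith [sq_nonneg τ]
  calc 𝔼 σ, (signSum q σ - clamp τ (signSum q σ)) ^ 2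
      ≤ 𝔼 σ, 2 / τ ^ 2 * Real.exp (-τ ^ 2) *
          (Real.exp (τ * signSum q σ) + Real.exp (-τ * signSum q σ)) :=
        Finset.expect_le_expect fun σ _ => sub_clamp_sq_le hτ _
    _ = 2 / τ ^ 2 * Real.exp (-τ ^ 2) * (𝔼 σ, Real.exp (τ * signSum q σ) +
          𝔼 σ, Real.exp (-τ * signSum q σ)) := by
        rw [← Finset.mul_expect, Finset.expect_add_distrib]
    _ ≤ 2 / τ ^ 2 * Real.exp (-τ ^ 2) * (Real.exp (τ ^ 2 / 2) + Real.exp (τ ^ 2 / 2)) := by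
        gcongr
        · exact h1 τ rfl
        · exact h1 (-τ) (by ring)
    _ = 4 / τ ^ 2 * (Real.exp (-τ ^ 2) * Real.exp (τ ^ 2 / 2)) := by ring
    _ = 4 / τ ^ 2 * Real.exp (-τ ^ 2 / 2) := by
        rw [← Real.exp_add]
        congr 2
        ring

/-- Truncating two Rademacher sums of variance at most one at level `τ` changes their covariance
only by an amount that is Gaussian in `τ`. -/
theorem expect_clamp_mul_clamp_le {ι : Type*} [Fintype ι] [DecidableEq ι] {τ : ℝ} (hτ : 0 < τ)
    (p q : ι → ℝ) (hp : ∑ k, p k ^ 2 ≤ 1) (hq : ∑ k, q k ^ 2 ≤ 1) :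
    𝔼 σ, clamp τ (signSum p σ) * clamp τ (signSum q σ) ≤
      ∑ k, p k * q k + 4 / τ * Real.exp (-τ ^ 2 / 4) := by
  -- The weight `l` balances the two terms in the inequality `|xy| ≤ (l x² + y² / l) / 2`.
  set l : ℝ := τ / 2 * Real.exp (τ ^ 2 / 4) with hl
  have hl0 : 0 < l := by positivity
  have hli : l⁻¹ = 2 / τ * Real.exp (-τ ^ 2 / 4) := by
    rw [hl, mul_inv, ← Real.exp_neg, inv_div, neg_div]
  have hle : l * (4 / τ ^ 2 * Real.exp (-τ ^ 2 / 2)) = 2 / τ * Real.exp (-τ ^ 2 / 4) := by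
    have : Real.exp (-τ ^ 2 / 4) = Real.exp (τ ^ 2 / 4) * Real.exp (-τ ^ 2 / 2) := by
      rw [← Real.exp_add]
      congr 1
      ring
    rw [this, hl]
    field_simp
    ring
  have hpt : ∀ x y c d : ℝ, |c| ≤ |x| → c * d ≤ x * y +
      (l * (x - c) ^ 2 + l⁻¹ * y ^ 2) / 2 + (l * (y - d) ^ 2 + l⁻¹ * x ^ 2) / 2 := by
    intro x y c d hcx
    have hc2 : c ^ 2 ≤ x ^ 2 := sq_le_sq.2 hcx
    have hA : ∀ r s : ℝ, -(r * s) ≤ (l * r ^ 2 + l⁻¹ * s ^ 2) / 2 := by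
      intro r s
      have h0 : 0 ≤ l⁻¹ * (l * r + s) ^ 2 := by positivity
      have h1 : l⁻¹ * (l * r + s) ^ 2 = l * r ^ 2 + l⁻¹ * s ^ 2 + 2 * (r * s) := by
        field_simp
        ring
      linarith
    have h1 := hA (x - c) y
    have h2 := hA (y - d) c
    have h3 : l⁻¹ * c ^ 2 ≤ l⁻¹ * x ^ 2 := by gcongr
    nlinarith
  have hvar : ∀ r : ι → ℝ, ∑ k, r k ^ 2 ≤ 1 → 𝔼 σ, signSum r σ ^ 2 ≤ 1 := by
    intro r hr
    simpa only [sq, expect_signSum_mul] using hr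
  have hp1 := expect_sub_clamp_sq_le hτ p hp
  have hq1 := expect_sub_clamp_sq_le hτ q hq
  calc 𝔼 σ, clamp τ (signSum p σ) * clamp τ (signSum q σ)
      ≤ 𝔼 σ, (signSum p σ * signSum q σ +
        (l * (signSum p σ - clamp τ (signSum p σ)) ^ 2 + l⁻¹ * signSum q σ ^ 2) / 2 +
        (l * (signSum q σ - clamp τ (signSum q σ)) ^ 2 + l⁻¹ * signSum p σ ^ 2) / 2) :=
        Finset.expect_le_expect fun σ _ => hpt _ _ _ _ (abs_clamp_le_abs hτ _)
    _ = ∑ k, p k * q k +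
        (l * 𝔼 σ, (signSum p σ - clamp τ (signSum p σ)) ^ 2 + l⁻¹ * 𝔼 σ, signSum q σ ^ 2) / 2 +
        (l * 𝔼 σ, (signSum q σ - clamp τ (signSum q σ)) ^ 2 + l⁻¹ * 𝔼 σ, signSum p σ ^ 2) / 2 := by
        simp only [Finset.expect_add_distrib, ← Finset.expect_div, ← Finset.mul_expect,
          expect_signSum_mul]
    _ ≤ ∑ k, p k * q k +
        (l * (4 / τ ^ 2 * Real.exp (-τ ^ 2 / 2)) + l⁻¹ * 1) / 2 +
        (l * (4 / τ ^ 2 * Real.exp (-τ ^ 2 / 2)) + l⁻¹ * 1) / 2 := by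
        gcongr
        · exact hvar q hq
        · exact hvar p hp
    _ = ∑ k, p k * q k + 4 / τ * Real.exp (-τ ^ 2 / 4) := by
        rw [hle, hli]
        ring

/-- A quadratic form with zero diagonal is affine in every coordinate, so on the cube `[-1, 1]^V`
it is minimised at a vertex. -/
theorem exists_sign_le {V : Type*} [Fintype V] [DecidableEq V] (A : Matrix V V ℝ)
    (hA : ∀ i, A i i = 0) (z : V → ℝ) (hz : ∀ i, |z i| ≤ 1) :
    ∃ x : V → ℝ, (∀ i, x i = 1 ∨ x i = -1) ∧
      ∑ i, ∑ j, A i j * (x i * x j) ≤ ∑ i, ∑ j, A i j * (z i * z j) := by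
  suffices H : ∀ s : Finset V, ∃ x : V → ℝ, (∀ i, |x i| ≤ 1) ∧ (∀ i ∈ s, x i = 1 ∨ x i = -1) ∧
      ∑ i, ∑ j, A i j * (x i * x j) ≤ ∑ i, ∑ j, A i j * (z i * z j) by
    obtain ⟨x, -, h1, h2⟩ := H Finset.univ
    exact ⟨x, fun i => h1 i (Finset.mem_univ i), h2⟩
  intro s
  induction s using Finset.induction_on with
  | empty => exact ⟨z, hz, by simp, le_rfl⟩
  | insert k s hk ih =>
    obtain ⟨x, hx1, hxs, hxz⟩ := ih
    set b : ℝ := ∑ j, A k j * x j + ∑ i, A i k * x i with hb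
    have haff : ∀ t : ℝ, ∑ i, ∑ j, A i j * (Function.update x k t i * Function.update x k t j) =
        ∑ i, ∑ j, A i j * (x i * x j) + (t - x k) * b := by
      intro t
      have hu : ∀ i, Function.update x k t i = x i + (t - x k) * (if i = k then 1 else 0) := by
        intro i
        by_cases h : i = k
        · subst h
          simp
        · simp [h]
      have hterm : ∀ i j, A i j * (Function.update x k t i * Function.update x k t j) =
          A i j * (x i * x j) + (t - x k) * ((if i = k then A i j * x j else 0) +
            (if j = k then A i j * x i else 0)) := by
        intro i j
        rw [hu, hu]
        by_cases h : i = k <;> by_cases h' : j = k <;> simp only [h, h', if_true, if_false]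
        · rw [hA]
          ring
        all_goals ring
      simp only [hterm, Finset.sum_add_distrib, ← Finset.mul_sum]
      congr 2
      rw [hb]
      congr 1
      · rw [Finset.sum_comm]
        simp
      · simp
    -- Move the coordinate in the direction in which the form decreases.
    have hstep : ∃ t : ℝ, (t = 1 ∨ t = -1) ∧ (t - x k) * b ≤ 0 := by
      have hxk := abs_le.1 (hx1 k)
      rcases le_total 0 b with h | h
      · exact ⟨-1, Or.inr rfl, mul_nonpos_of_nonpos_of_nonneg (by linarith) h⟩
      · exact ⟨1, Or.inl rfl, mul_nonpos_of_nonneg_of_nonpos (by linarith) h⟩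
    obtain ⟨t, ht, htb⟩ := hstep
    refine ⟨Function.update x k t, fun i => ?_, fun i hi => ?_, ?_⟩
    · by_cases h : i = k
      · subst h
        rcases ht with rfl | rfl <;> simp
      · simpa [h] using hx1 i
    · by_cases h : i = k
      · subst h
        simpa using ht
      · simpa [h] using hxs i ((Finset.mem_insert.1 hi).resolve_left h)
    · rw [haff]
      linarith

/-- Rounding of a semidefinite solution to signs. If `X = Qᵀ Q`, the vector `Qᵀ σ` with random
signs `σ` has covariance `X`; truncating it at level `τ` and rescaling puts it into the cube
`[-1, 1]^V`, where it can be replaced by a vertex. -/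
theorem exists_sign_le_of_posSemidef {V : Type*} [Fintype V] [DecidableEq V] (A X : Matrix V V ℝ)
    (hA : ∀ i, A i i = 0) (hA0 : ∀ i j, 0 ≤ A i j) (hX : X.PosSemidef) (hX1 : ∀ i, X i i ≤ 1)
    {τ : ℝ} (hτ : 0 < τ) :
    ∃ x : V → ℝ, (∀ i, x i = 1 ∨ x i = -1) ∧
      ∑ i, ∑ j, A i j * (x i * x j) ≤
        (∑ i, ∑ j, A i j * X i j + 4 / τ * Real.exp (-τ ^ 2 / 4) * ∑ i, ∑ j, A i j) / τ ^ 2 := by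
  obtain ⟨n, Q, hQ⟩ := Matrix.posSemidef_iff_eq_sum_vecMulVec.1 hX
  have hXe : ∀ i j, X i j = ∑ k, Q k i * Q k j := by
    intro i j
    rw [hQ, Matrix.sum_apply]
    simp [Matrix.vecMulVec_apply]
  have hnorm : ∀ i, ∑ k, Q k i ^ 2 ≤ 1 := by
    intro i
    have := hX1 i
    rw [hXe] at this
    simpa only [sq] using this
  have hexp : 𝔼 σ : Fin n → Bool, ∑ i, ∑ j, A i j *
      (clamp τ (signSum (fun k => Q k i) σ) * clamp τ (signSum (fun k => Q k j) σ)) ≤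
      ∑ i, ∑ j, A i j * X i j + 4 / τ * Real.exp (-τ ^ 2 / 4) * ∑ i, ∑ j, A i j := by
    simp only [Finset.expect_sum_comm, ← Finset.mul_expect]
    rw [Finset.mul_sum, ← Finset.sum_add_distrib]
    refine Finset.sum_le_sum fun i _ => ?_
    rw [Finset.mul_sum, ← Finset.sum_add_distrib]
    refine Finset.sum_le_sum fun j _ => ?_
    have h := expect_clamp_mul_clamp_le hτ (fun k => Q k i) (fun k => Q k j) (hnorm i) (hnorm j)
    rw [← hXe] at h
    nlinarith [mul_le_mul_of_nonneg_left h (hA0 i j)]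
  obtain ⟨σ, -, hσ⟩ := Finset.exists_le_of_expect_le Finset.univ_nonempty hexp
  obtain ⟨x, hx, hxz⟩ := exists_sign_le A hA
    (fun i => clamp τ (signSum (fun k => Q k i) σ) / τ) (fun i => by
      rw [abs_div, abs_of_pos hτ, div_le_one hτ]
      exact abs_clamp_le hτ _)
  refine ⟨x, hx, hxz.trans ?_⟩
  rw [le_div_iff₀ (by positivity)]
  refine le_trans (le_of_eq ?_) hσ
  rw [Finset.sum_mul]
  refine Finset.sum_congr rfl fun i _ => ?_
  rw [Finset.sum_mul]
  refine Finset.sum_congr rfl fun j _ => ?_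
  field_simp

/-! ### A bounded odd function of a symmetric matrix -/

/-- The matrix function `y ↦ 2 y / (1 + y²)`: an odd function with values in `[-1, 1]` which agrees
with `2 y` to second order. -/
noncomputable def oddCutoff {V : Type*} [Fintype V] [DecidableEq V] (Y : Matrix V V ℝ) :
    Matrix V V ℝ := (2 : ℝ) • (Y * (1 + Y * Y)⁻¹)

theorem oddCutoff_neg {V : Type*} [Fintype V] [DecidableEq V] (Y : Matrix V V ℝ) :
    oddCutoff (-Y) = -oddCutoff Y := by
  simp [oddCutoff]

theorem posDef_one_add_sq {V : Type*} [Fintype V] [DecidableEq V] {Y : Matrix V V ℝ}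
    (hY : Y.IsHermitian) : (1 + Y * Y).PosDef := by
  refine Matrix.PosDef.one.add_posSemidef ?_
  have := Matrix.posSemidef_conjTranspose_mul_self Y
  rwa [hY.eq] at this

theorem isUnit_det_one_add_sq {V : Type*} [Fintype V] [DecidableEq V] {Y : Matrix V V ℝ}
    (hY : Y.IsHermitian) : IsUnit (1 + Y * Y).det :=
  (Matrix.isUnit_iff_isUnit_det _).1 (posDef_one_add_sq hY).isUnit

theorem commute_inv_one_add_sq {V : Type*} [Fintype V] [DecidableEq V] {Y : Matrix V V ℝ}
    (hY : Y.IsHermitian) : Commute (1 + Y * Y)⁻¹ Y := by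
  have hdet := isUnit_det_one_add_sq hY
  have hcomm : Commute (1 + Y * Y) Y :=
    (Commute.one_left Y).add_left ((Commute.refl Y).mul_left (Commute.refl Y))
  set S := 1 + Y * Y
  have : S⁻¹ * (S * Y) * S⁻¹ = S⁻¹ * (Y * S) * S⁻¹ := by rw [hcomm.eq]
  rw [← mul_assoc, Matrix.nonsing_inv_mul _ hdet, one_mul, mul_assoc, mul_assoc,
    Matrix.mul_nonsing_inv _ hdet, mul_one] at this
  exact this.symm

theorem posSemidef_one_sub_oddCutoff {V : Type*} [Fintype V] [DecidableEq V] {Y : Matrix V V ℝ}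
    (hY : Y.IsHermitian) : (1 - oddCutoff Y).PosSemidef := by
  have h := (posDef_one_add_sq hY).inv.posSemidef.mul_mul_conjTranspose_same (1 - Y)
  have hh : (1 - Y).conjTranspose = 1 - Y := by
    rw [Matrix.conjTranspose_sub, Matrix.conjTranspose_one, hY.eq]
  rw [hh] at h
  -- `1 - 2 y / (1 + y²) = (1 - y)² / (1 + y²)`
  have he : (1 - Y) * (1 + Y * Y)⁻¹ * (1 - Y) = 1 - oddCutoff Y := by
    have hS := Matrix.mul_nonsing_inv _ (isUnit_det_one_add_sq hY)
    have hc := (commute_inv_one_add_sq hY).eq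
    rw [oddCutoff]
    generalize (1 + Y * Y)⁻¹ = R at hS hc ⊢
    have h2 : (1 - Y) * R * (1 - Y) = R - Y * R - R * Y + Y * (R * Y) := by
      noncomm_ring
    rw [h2, hc, ← hS, two_smul]
    noncomm_ring
  rwa [he] at h

theorem sum_sq_eq_trace {V : Type*} [Fintype V] {N : Matrix V V ℝ} (hN : N.transpose = N) :
    ∑ a, ∑ b, N a b ^ 2 = (N * N).trace := by
  nth_rewrite 3 [← hN]
  simp only [Matrix.trace, Matrix.diag, Matrix.mul_apply, Matrix.transpose_apply, sq]

/-- The error `2 y - 2 y / (1 + y²)` of the cutoff is at most `y²` in absolute value; for matrices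
this holds in the Frobenius norm. -/
theorem sum_sub_oddCutoff_sq_le {V : Type*} [Fintype V] [DecidableEq V] {Y : Matrix V V ℝ}
    (hY : Y.IsHermitian) :
    ∑ a, ∑ b, (2 * Y a b - oddCutoff Y a b) ^ 2 ≤ ∑ a, ∑ b, (Y * Y) a b ^ 2 := by
  have hS := Matrix.mul_nonsing_inv _ (isUnit_det_one_add_sq hY)
  have hc := commute_inv_one_add_sq hY
  have hYt : Y.transpose = Y := by
    have := hY.eq
    rwa [Matrix.conjTranspose_eq_transpose_of_trivial] at this
  have hRt : ((1 + Y * Y)⁻¹).transpose = (1 + Y * Y)⁻¹ := by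
    have := (posDef_one_add_sq hY).inv.isHermitian.eq
    rwa [Matrix.conjTranspose_eq_transpose_of_trivial] at this
  have hN : ∀ a b, 2 * Y a b - oddCutoff Y a b = ((2 : ℝ) • Y - oddCutoff Y) a b := by
    intro a b
    simp
  simp only [hN]
  rw [oddCutoff]
  generalize (1 + Y * Y)⁻¹ = R at hS hc hRt ⊢
  have hWR : Commute R (Y * Y) := hc.mul_right hc
  have hPR : Commute R (Y * (Y * Y)) := hc.mul_right hWR
  have hTR : Commute R (Y * Y * (1 - Y * Y)) :=
    hWR.mul_right ((Commute.one_right R).sub_right hWR)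
  have hN' : (2 : ℝ) • Y - (2 : ℝ) • (Y * R) = (2 : ℝ) • (Y * (Y * Y) * R) := by
    have : Y = Y * ((1 + Y * Y) * R) := by rw [hS, mul_one]
    nth_rewrite 1 [this]
    rw [← smul_sub]
    congr 1
    noncomm_ring
  rw [hN']
  set P := Y * (Y * Y) with hP
  set T := Y * Y * (1 - Y * Y) with hT
  have hPt : P.transpose = P := by
    simp only [hP, Matrix.transpose_mul, hYt, mul_assoc]
  have hTt : T.transpose = T := by
    simp only [hT, Matrix.transpose_mul, Matrix.transpose_sub, Matrix.transpose_one, hYt]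
    noncomm_ring
  have h1 : ((2 : ℝ) • (P * R)).transpose = (2 : ℝ) • (P * R) := by
    rw [Matrix.transpose_smul, Matrix.transpose_mul, hPt, hRt, hPR.eq]
  have h2 : (T * R).transpose = T * R := by
    rw [Matrix.transpose_mul, hTt, hRt, hTR.eq]
  have h3 : (Y * Y).transpose = Y * Y := by
    rw [Matrix.transpose_mul, hYt]
  -- `4 y⁶ + y⁴ (1 - y²)² = y⁴ (1 + y²)²`
  have hkey : ((2 : ℝ) • (P * R)) * ((2 : ℝ) • (P * R)) + T * R * (T * R) = Y * Y * (Y * Y) := by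
    have e1 : P * R * (P * R) = P * P * (R * R) := hPR.mul_mul_mul_comm _ _
    have e2 : T * R * (T * R) = T * T * (R * R) := hTR.mul_mul_mul_comm _ _
    have e3 : P * P + P * P + (P * P + P * P) + T * T =
        Y * Y * (Y * Y) * ((1 + Y * Y) * (1 + Y * Y)) := by
      rw [hP, hT]
      noncomm_ring
    have e4 : (1 + Y * Y) * (1 + Y * Y) * (R * R) = 1 := by
      rw [mul_assoc, ← mul_assoc _ R R, hS, one_mul, hS]
    rw [two_smul, add_mul, mul_add, e1, e2, ← add_mul, ← add_mul, ← add_mul, e3, mul_assoc, e4,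
      mul_one]
  rw [sum_sq_eq_trace h1, sum_sq_eq_trace h3, ← hkey, Matrix.trace_add, ← sum_sq_eq_trace h2]
  have : 0 ≤ ∑ a, ∑ b, (T * R) a b ^ 2 :=
    Finset.sum_nonneg fun _ _ => Finset.sum_nonneg fun _ _ => sq_nonneg _
  linarith

/-! ### Indicator functions of 3-graphs -/

/-- The indicator function, on ordered triples of vertices, of the edge set of a 3-graph: it is
symmetric, takes the values `0` and `1`, and vanishes unless the three vertices are distinct. -/
structure IsTripleSystem {V : Type*} (h : V → V → V → ℝ) : Prop where
  zero_or_one : ∀ v a b, h v a b = 0 ∨ h v a b = 1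
  swap_right : ∀ v a b, h v a b = h v b a
  rotate : ∀ v a b, h v a b = h a b v
  ne_of_ne_zero : ∀ v a b, h v a b ≠ 0 → v ≠ a

namespace IsTripleSystem

variable {V : Type*} {h : V → V → V → ℝ}

theorem nonneg (hh : IsTripleSystem h) (v a b : V) : 0 ≤ h v a b := by
  rcases hh.zero_or_one v a b with e | e <;> simp [e]

theorem le_one (hh : IsTripleSystem h) (v a b : V) : h v a b ≤ 1 := by
  rcases hh.zero_or_one v a b with e | e <;> simp [e]

theorem mul_self (hh : IsTripleSystem h) (v a b : V) : h v a b * h v a b = h v a b := by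
  rcases hh.zero_or_one v a b with e | e <;> simp [e]

theorem distinct (hh : IsTripleSystem h) {v a b : V} (h0 : h v a b ≠ 0) :
    v ≠ a ∧ v ≠ b ∧ a ≠ b := by
  refine ⟨hh.ne_of_ne_zero _ _ _ h0, hh.ne_of_ne_zero v b a ?_, hh.ne_of_ne_zero a b v ?_⟩
  · rwa [← hh.swap_right]
  · rwa [← hh.rotate]

theorem diag (hh : IsTripleSystem h) (v a : V) : h v a a = 0 := by
  by_contra h0
  exact (hh.distinct h0).2.2 rfl

end IsTripleSystem

/-! ### Random 3-colourings -/

/-- Indicator of the colour `0`. -/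
def zeroInd (c : Fin 3) : ℝ := if c = 0 then 1 else 0

/-- Indicator of the colour `2`. -/
def twoInd (c : Fin 3) : ℝ := if c = 2 then 1 else 0

/-- The sign that distinguishes the colours `2` and `1`; it vanishes on the colour `0`. -/
def colorSign (c : Fin 3) : ℝ := if c = 2 then 1 else if c = 1 then -1 else 0

/-- The exchange of the colours `1` and `2`. -/
def colorSwap (c : Fin 3) : Fin 3 := Equiv.swap 1 2 c

theorem colorSwap_involutive : Function.Involutive colorSwap := by
  intro c
  simp [colorSwap]

theorem zeroInd_colorSwap (c : Fin 3) : zeroInd (colorSwap c) = zeroInd c := by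
  revert c
  simp [Fin.forall_fin_succ, zeroInd, colorSwap, Equiv.swap_apply_def]

theorem colorSign_colorSwap (c : Fin 3) : colorSign (colorSwap c) = -colorSign c := by
  revert c
  simp [Fin.forall_fin_succ, colorSign, colorSwap, Equiv.swap_apply_def]

theorem zeroInd_mul_self (c : Fin 3) : zeroInd c * zeroInd c = zeroInd c := by
  unfold zeroInd
  split_ifs <;> simp

theorem zeroInd_nonneg (c : Fin 3) : 0 ≤ zeroInd c := by
  unfold zeroInd
  split_ifs <;> simp

theorem zeroInd_le_one (c : Fin 3) : zeroInd c ≤ 1 := by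
  unfold zeroInd
  split_ifs <;> simp

theorem expect_three_mul {ι κ : Type*} [Fintype ι] [DecidableEq ι] [Fintype κ] [Nonempty κ]
    {v a b : ι} (hva : v ≠ a) (hvb : v ≠ b) (hab : a ≠ b) (p q r : κ → ℝ) :
    𝔼 f : ι → κ, p (f v) * q (f a) * r (f b) = (𝔼 c, p c) * (𝔼 c, q c) * (𝔼 c, r c) := by
  have h := expect_prod_apply (ι := ι) (κ := κ) (fun i c => (if i = v then p c else 1) *
    (if i = a then q c else 1) * (if i = b then r c else 1))
  simp only [Finset.prod_mul_distrib, Finset.prod_ite_eq', Finset.mem_univ, if_true] at h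
  rw [h]
  have h2 : ∀ i, (𝔼 c, (if i = v then p c else 1) * (if i = a then q c else 1) *
      (if i = b then r c else 1)) = (if i = v then 𝔼 c, p c else 1) *
      (if i = a then 𝔼 c, q c else 1) * (if i = b then 𝔼 c, r c else 1) := by
    intro i
    have h1 : (𝔼 _c : κ, (1 : ℝ)) = 1 := Fintype.expect_const 1
    by_cases e1 : i = v
    · subst e1
      simp [hva, hvb]
    · by_cases e2 : i = a
      · subst e2
        simp [e1, hab]
      · by_cases e3 : i = b
        · subst e3
          simp [e1, e2]
        · simp [e1, e2, e3, h1]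
  simp only [h2, Finset.prod_mul_distrib, Finset.prod_ite_eq', Finset.mem_univ, if_true]

/-- Invariance of a function of the colouring under exchanging the colours `1` and `2` at a single
vertex. -/
def SwapInvariant {V : Type*} [DecidableEq V] (U : (V → Fin 3) → ℝ) : Prop :=
  ∀ f i, U (Function.update f i (colorSwap (f i))) = U f

theorem swapInvariant_zeroInd {V : Type*} [DecidableEq V] (a : V) :
    SwapInvariant fun f : V → Fin 3 => zeroInd (f a) := by
  intro f i
  by_cases h : a = i
  · subst h
    simp [zeroInd_colorSwap]
  · simp [h]

theorem SwapInvariant.mul {V : Type*} [DecidableEq V] {U W : (V → Fin 3) → ℝ}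
    (hU : SwapInvariant U) (hW : SwapInvariant W) : SwapInvariant fun f => U f * W f := by
  intro f i
  simp only [hU f i, hW f i]

section Moments

variable {V : Type*} [Fintype V] [DecidableEq V] {U : (V → Fin 3) → ℝ}

theorem expect_colorSign_two (hU : SwapInvariant U) {v w : V} (hvw : v ≠ w) :
    𝔼 f, U f * (colorSign (f v) * colorSign (f w)) = 0 := by
  refine expect_eq_zero_of_update colorSwap colorSwap_involutive v _ fun f => ?_
  simp [hU f v, Function.update_of_ne hvw.symm, colorSign_colorSwap]

theorem expect_colorSign_four (hU : SwapInvariant U) {v w x y : V} (hw : v ≠ w) (hx : v ≠ x)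
    (hy : v ≠ y) :
    𝔼 f, U f * (colorSign (f v) * colorSign (f w) * colorSign (f x) * colorSign (f y)) = 0 := by
  refine expect_eq_zero_of_update colorSwap colorSwap_involutive v _ fun f => ?_
  simp [hU f v, Function.update_of_ne hw.symm, Function.update_of_ne hx.symm,
    Function.update_of_ne hy.symm, colorSign_colorSwap]

theorem expect_colorSign_four_le (hU : SwapInvariant U) (hU0 : ∀ f, 0 ≤ U f) (hU1 : ∀ f, U f ≤ 1)
    (i j k l : V) :
    𝔼 f, U f * (colorSign (f i) * colorSign (f j) * colorSign (f k) * colorSign (f l)) ≤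
      (if i = j then 1 else 0) * (if k = l then 1 else 0) +
      (if i = k then 1 else 0) * (if j = l then 1 else 0) +
      (if i = l then 1 else 0) * (if j = k then 1 else 0) := by
  have hs : ∀ c, |colorSign c| ≤ 1 := by
    intro c
    unfold colorSign
    split_ifs <;> simp
  have hle : 𝔼 f, U f * (colorSign (f i) * colorSign (f j) * colorSign (f k) * colorSign (f l)) ≤
      1 := by
    refine Finset.expect_le Finset.univ_nonempty fun f _ => ?_
    refine (le_abs_self _).trans ?_
    simp only [abs_mul, abs_of_nonneg (hU0 f)]
    refine mul_le_one₀ (hU1 f) (by positivity) ?_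
    refine mul_le_one₀ ?_ (abs_nonneg _) (hs _)
    refine mul_le_one₀ ?_ (abs_nonneg _) (hs _)
    exact mul_le_one₀ (hs _) (abs_nonneg _) (hs _)
  have hnn : ∀ (p q : Prop) [Decidable p] [Decidable q],
      (0 : ℝ) ≤ (if p then 1 else 0) * (if q then 1 else 0) := by
    intro p q _ _
    split_ifs <;> simp
  by_cases hij : i = j
  · by_cases hkl : k = l
    · rw [if_pos hij, if_pos hkl]
      linarith [hnn (i = k) (j = l), hnn (i = l) (j = k)]
    · -- One of `k`, `l` differs from all other indices.
      have hz : 𝔼 f, U f * (colorSign (f i) * colorSign (f j) * colorSign (f k) *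
          colorSign (f l)) = 0 := by
        subst hij
        by_cases hki : k = i
        · subst hki
          rw [← expect_colorSign_four hU (Ne.symm hkl) (Ne.symm hkl) (Ne.symm hkl)]
          exact Finset.expect_congr rfl fun f _ => by ring
        · rw [← expect_colorSign_four hU hki hki hkl]
          exact Finset.expect_congr rfl fun f _ => by ring
      rw [hz]
      linarith [hnn (i = j) (k = l), hnn (i = k) (j = l), hnn (i = l) (j = k)]
  · by_cases hik : i = k
    · by_cases hjl : j = l
      · rw [if_pos hik, if_pos hjl]
        linarith [hnn (i = j) (k = l), hnn (i = l) (j = k)]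
      · have hz : 𝔼 f, U f * (colorSign (f i) * colorSign (f j) * colorSign (f k) *
            colorSign (f l)) = 0 := by
          subst hik
          rw [← expect_colorSign_four hU (Ne.symm hij) (Ne.symm hij) hjl]
          exact Finset.expect_congr rfl fun f _ => by ring
        rw [hz]
        linarith [hnn (i = j) (k = l), hnn (i = k) (j = l), hnn (i = l) (j = k)]
    · by_cases hil : i = l
      · by_cases hjk : j = k
        · rw [if_pos hil, if_pos hjk]
          linarith [hnn (i = j) (k = l), hnn (i = k) (j = l)]
        · have hz : 𝔼 f, U f * (colorSign (f i) * colorSign (f j) * colorSign (f k) *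
              colorSign (f l)) = 0 := by
            subst hil
            rw [← expect_colorSign_four hU (Ne.symm hij) hjk (Ne.symm hij)]
            exact Finset.expect_congr rfl fun f _ => by ring
          rw [hz]
          linarith [hnn (i = j) (k = l), hnn (i = k) (j = l), hnn (i = l) (j = k)]
      · rw [expect_colorSign_four hU hij hik hil]
        linarith [hnn (i = j) (k = l), hnn (i = k) (j = l), hnn (i = l) (j = k)]

/-- The linear form `∑ p v ε v` in the random signs given by a colouring. -/
def colorSum (p : V → ℝ) (f : V → Fin 3) : ℝ := ∑ v, colorSign (f v) * p v

theorem expect_colorSum_mul (hU : SwapInvariant U) (p q : V → ℝ) :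
    𝔼 f, U f * (colorSum p f * colorSum q f) =
      ∑ v, p v * q v * 𝔼 f, U f * (colorSign (f v) * colorSign (f v)) := by
  have h1 : ∀ f, U f * (colorSum p f * colorSum q f) =
      ∑ v, ∑ w, (p v * q w) * (U f * (colorSign (f v) * colorSign (f w))) := by
    intro f
    rw [colorSum, colorSum, Finset.sum_mul_sum, Finset.mul_sum]
    refine Finset.sum_congr rfl fun v _ => ?_
    rw [Finset.mul_sum]
    exact Finset.sum_congr rfl fun w _ => by ring
  simp only [h1, Finset.expect_sum_comm, ← Finset.mul_expect]
  refine Finset.sum_congr rfl fun v _ => ?_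
  refine Finset.sum_eq_single v (fun w _ hw => ?_) (by simp)
  rw [expect_colorSign_two hU (Ne.symm hw), mul_zero]

theorem sum_four_mul_delta (p q r s : V → ℝ) :
    ∑ i, ∑ j, ∑ k, ∑ l, p i * q j * r k * s l *
      ((if i = j then 1 else 0) * (if k = l then 1 else 0)) =
      (∑ v, p v * q v) * ∑ v, r v * s v := by
  have h : ∀ i j k l, p i * q j * r k * s l *
      ((if i = j then 1 else 0) * (if k = l then 1 else 0)) =
      (if i = j then p i * q j else 0) * (if k = l then r k * s l else 0) := by
    intro i j k l
    split_ifs <;> ring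
  simp only [h, ← Finset.mul_sum, ← Finset.sum_mul]
  simp

/-- Wick-type bound for the fourth mixed moment of the random signs: only the three pairings
contribute. -/
theorem expect_colorSum_four_le (hU : SwapInvariant U) (hU0 : ∀ f, 0 ≤ U f) (hU1 : ∀ f, U f ≤ 1)
    (p q r s : V → ℝ) (hp : ∀ v, 0 ≤ p v) (hq : ∀ v, 0 ≤ q v) (hr : ∀ v, 0 ≤ r v)
    (hs : ∀ v, 0 ≤ s v) :
    𝔼 f, U f * (colorSum p f * colorSum q f * colorSum r f * colorSum s f) ≤
      (∑ v, p v * q v) * (∑ v, r v * s v) + (∑ v, p v * r v) * (∑ v, q v * s v) +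
      (∑ v, p v * s v) * (∑ v, q v * r v) := by
  have h1 : ∀ f, U f * (colorSum p f * colorSum q f * colorSum r f * colorSum s f) =
      ∑ i, ∑ j, ∑ k, ∑ l, (p i * q j * r k * s l) *
        (U f * (colorSign (f i) * colorSign (f j) * colorSign (f k) * colorSign (f l))) := by
    intro f
    have h2 : ∀ i j k l, (p i * q j * r k * s l) *
        (U f * (colorSign (f i) * colorSign (f j) * colorSign (f k) * colorSign (f l))) =
        U f * ((colorSign (f i) * p i) * (colorSign (f j) * q j) * (colorSign (f k) * r k) *
          (colorSign (f l) * s l)) := by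
      intro i j k l
      ring
    simp only [h2, ← Finset.mul_sum, ← Finset.sum_mul, colorSum]
  simp only [h1, Finset.expect_sum_comm, ← Finset.mul_expect]
  have h2 : ∀ i j k l, (p i * q j * r k * s l) *
      𝔼 f, U f * (colorSign (f i) * colorSign (f j) * colorSign (f k) * colorSign (f l)) ≤
      p i * q j * r k * s l * ((if i = j then 1 else 0) * (if k = l then 1 else 0)) +
      p i * r k * q j * s l * ((if i = k then 1 else 0) * (if j = l then 1 else 0)) +
      p i * s l * q j * r k * ((if i = l then 1 else 0) * (if j = k then 1 else 0)) := by
    intro i j k l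
    have hnn : 0 ≤ p i * q j * r k * s l :=
      mul_nonneg (mul_nonneg (mul_nonneg (hp i) (hq j)) (hr k)) (hs l)
    refine (mul_le_mul_of_nonneg_left (expect_colorSign_four_le hU hU0 hU1 i j k l) hnn).trans
      (le_of_eq ?_)
    ring
  refine (Finset.sum_le_sum fun i _ => Finset.sum_le_sum fun j _ => Finset.sum_le_sum fun k _ =>
    Finset.sum_le_sum fun l _ => h2 i j k l).trans (le_of_eq ?_)
  simp only [Finset.sum_add_distrib]
  congr 1
  · congr 1
    · exact sum_four_mul_delta p q r s
    · rw [← sum_four_mul_delta p r q s]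
      exact Finset.sum_congr rfl fun i _ => Finset.sum_comm
  · rw [← sum_four_mul_delta p s q r]
    refine Finset.sum_congr rfl fun i _ => ?_
    exact (Finset.sum_congr rfl fun j _ => Finset.sum_comm).trans Finset.sum_comm

end Moments

/-! ### Moments of the signed link matrix -/

section

variable {V : Type*} [Fintype V] {h g : V → V → V → ℝ}

/-- The random signed combination of the link graphs `g v` of the vertices `v` of colours `1` and
`2`, restricted to the vertices of colour `0`. -/
noncomputable def signedLink (g : V → V → V → ℝ) (f : V → Fin 3) : Matrix V V ℝ := fun a b =>
  zeroInd (f a) * zeroInd (f b) * colorSum (fun v => g v a b) f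

theorem signedLink_isHermitian (hg : ∀ v a b, g v a b = g v b a) (f : V → Fin 3) :
    (signedLink g f).IsHermitian := by
  ext a b
  simp only [Matrix.conjTranspose_apply, signedLink, star_trivial, hg _ b a]
  ring

theorem signedLink_colorSwap (f : V → Fin 3) :
    signedLink g (fun i => colorSwap (f i)) = -signedLink g f := by
  ext a b
  simp [signedLink, colorSum, zeroInd_colorSwap, colorSign_colorSwap]

variable [DecidableEq V]

/-- `2/27` is the probability that `a` and `b` have colour `0` and `v` has not. -/
theorem expect_sum_signedLink_mul (hh : IsTripleSystem h) :
    𝔼 f, ∑ a, ∑ b, signedLink h f a b * signedLink g f a b =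
      2 / 27 * ∑ a, ∑ b, ∑ v, h v a b * g v a b := by
  simp only [Finset.expect_sum_comm, Finset.mul_sum]
  refine Finset.sum_congr rfl fun a _ => Finset.sum_congr rfl fun b _ => ?_
  have h1 : ∀ f, signedLink h f a b * signedLink g f a b = zeroInd (f a) * zeroInd (f b) *
      (colorSum (fun v => h v a b) f * colorSum (fun v => g v a b) f) := by
    intro f
    have h2 := zeroInd_mul_self (f a)
    have h3 := zeroInd_mul_self (f b)
    calc _ = (zeroInd (f a) * zeroInd (f a)) * (zeroInd (f b) * zeroInd (f b)) *
        (colorSum (fun v => h v a b) f * colorSum (fun v => g v a b) f) := by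
          simp only [signedLink]
          ring
      _ = _ := by rw [h2, h3]
  simp only [h1]
  rw [expect_colorSum_mul ((swapInvariant_zeroInd a).mul (swapInvariant_zeroInd b))]
  refine Finset.sum_congr rfl fun v _ => ?_
  by_cases h0 : h v a b = 0
  · simp [h0]
  · obtain ⟨hva, hvb, hab⟩ := hh.distinct h0
    have h4 : ∀ f : V → Fin 3, zeroInd (f a) * zeroInd (f b) *
        (colorSign (f v) * colorSign (f v)) =
        (colorSign (f v) * colorSign (f v)) * zeroInd (f a) * zeroInd (f b) := by
      intro f
      ring
    simp only [h4]
    rw [expect_three_mul hva hvb hab (fun c => colorSign c * colorSign c) zeroInd zeroInd]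
    have e1 : 𝔼 c, zeroInd c = 1 / 3 := by
      rw [Fintype.expect_eq_sum_div_card]
      simp [zeroInd]
    have e2 : 𝔼 c, colorSign c * colorSign c = 2 / 3 := by
      rw [Fintype.expect_eq_sum_div_card]
      simp [Fin.sum_univ_succ, colorSign]
      norm_num
    rw [e1, e2]
    ring

/-- Fourth moment of the random matrix: closed walks of length four in which the labels `v` are
paired. A step with a new label costs `Δ`, a step with an old label costs `D`, and the last step is
determined. -/
theorem expect_sum_signedLink_sq_sq_le (hg0 : ∀ v a b, 0 ≤ g v a b) (hg1 : ∀ v a b, g v a b ≤ 1)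
    (hgs : ∀ v a b, g v a b = g v b a) {D Δ : ℝ} (hD0 : 0 ≤ D)
    (hD : ∀ v b, ∑ d, g v b d ≤ D) (hΔ : ∀ a, ∑ b, ∑ w, g w a b ≤ Δ) :
    𝔼 f, ∑ a, ∑ b, (signedLink g f * signedLink g f) a b ^ 2 ≤
      3 * (D * Δ * ∑ a, ∑ b, ∑ v, g v a b) := by
  set G := ∑ a, ∑ b, ∑ v, g v a b with hG
  have hexp : ∀ f, ∑ a, ∑ b, (signedLink g f * signedLink g f) a b ^ 2 =
      ∑ a, ∑ b, ∑ c, ∑ d, zeroInd (f a) * zeroInd (f b) * (zeroInd (f c) * zeroInd (f d)) *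
        (colorSum (fun v => g v a c) f * colorSum (fun v => g v c b) f *
          colorSum (fun v => g v a d) f * colorSum (fun v => g v d b) f) := by
    intro f
    refine Finset.sum_congr rfl fun a _ => Finset.sum_congr rfl fun b _ => ?_
    rw [sq, Matrix.mul_apply, Finset.sum_mul_sum]
    refine Finset.sum_congr rfl fun c _ => Finset.sum_congr rfl fun d _ => ?_
    have ha := zeroInd_mul_self (f a)
    have hb := zeroInd_mul_self (f b)
    have hc := zeroInd_mul_self (f c)
    have hd := zeroInd_mul_self (f d)
    calc _ = (zeroInd (f a) * zeroInd (f a)) * (zeroInd (f b) * zeroInd (f b)) *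
          ((zeroInd (f c) * zeroInd (f c)) * (zeroInd (f d) * zeroInd (f d))) *
          (colorSum (fun v => g v a c) f * colorSum (fun v => g v c b) f *
          colorSum (fun v => g v a d) f * colorSum (fun v => g v d b) f) := by
          simp only [signedLink]
          ring
      _ = _ := by rw [ha, hb, hc, hd]
  simp only [hexp, Finset.expect_sum_comm]
  have hwick : ∀ a b c d, 𝔼 f : V → Fin 3, zeroInd (f a) * zeroInd (f b) *
      (zeroInd (f c) * zeroInd (f d)) *
        (colorSum (fun v => g v a c) f * colorSum (fun v => g v c b) f *
          colorSum (fun v => g v a d) f * colorSum (fun v => g v d b) f) ≤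
      (∑ v, g v a c * g v c b) * (∑ w, g w a d) +
      (∑ v, g v a c * g v a d) * (∑ w, g w c b) +
      (∑ v, g v a c * g v d b) * (∑ w, g w c b) := by
    intro a b c d
    refine (expect_colorSum_four_le
      (((swapInvariant_zeroInd a).mul (swapInvariant_zeroInd b)).mul
        ((swapInvariant_zeroInd c).mul (swapInvariant_zeroInd d)))
      (fun f => mul_nonneg (mul_nonneg (zeroInd_nonneg _) (zeroInd_nonneg _))
        (mul_nonneg (zeroInd_nonneg _) (zeroInd_nonneg _)))
      (fun f => mul_le_one₀ (mul_le_one₀ (zeroInd_le_one _) (zeroInd_nonneg _) (zeroInd_le_one _))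
        (mul_nonneg (zeroInd_nonneg _) (zeroInd_nonneg _))
        (mul_le_one₀ (zeroInd_le_one _) (zeroInd_nonneg _) (zeroInd_le_one _)))
      (fun v => g v a c) (fun v => g v c b) (fun v => g v a d) (fun v => g v d b)
      (fun _ => hg0 _ _ _) (fun _ => hg0 _ _ _) (fun _ => hg0 _ _ _)
      (fun _ => hg0 _ _ _)).trans ?_
    -- In each pairing one factor, the last step of the closed walk, is bounded by one.
    have hl : ∀ v a b c d, g v a b * g v c d ≤ g v a b := fun v a b c d =>
      mul_le_of_le_one_right (hg0 _ _ _) (hg1 _ _ _)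
    have hs : ∀ x y z t, 0 ≤ ∑ v, g v x y * g v z t := fun x y z t =>
      Finset.sum_nonneg fun v _ => mul_nonneg (hg0 _ _ _) (hg0 _ _ _)
    refine add_le_add (add_le_add ?_ ?_) ?_
    · exact mul_le_mul_of_nonneg_left (Finset.sum_le_sum fun _ _ => hl _ _ _ _ _) (hs _ _ _ _)
    · exact mul_le_mul_of_nonneg_left (Finset.sum_le_sum fun _ _ => hl _ _ _ _ _) (hs _ _ _ _)
    · exact mul_le_mul_of_nonneg_left (Finset.sum_le_sum fun _ _ => hl _ _ _ _ _) (hs _ _ _ _)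
  have hs0 : ∀ x y, 0 ≤ ∑ v, g v x y := fun x y => Finset.sum_nonneg fun v _ => hg0 _ _ _
  -- A second step with the same label as the first.
  have hstep : ∀ a c x, ∑ b, ∑ v, g v a c * g v x b ≤ D * ∑ v, g v a c := by
    intro a c x
    rw [Finset.sum_comm, Finset.mul_sum]
    refine Finset.sum_le_sum fun v _ => ?_
    rw [← Finset.mul_sum, mul_comm D]
    exact mul_le_mul_of_nonneg_left (hD _ _) (hg0 _ _ _)
  have hstep' : ∀ a c x, ∑ b, ∑ v, g v a c * g v b x ≤ D * ∑ v, g v a c := by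
    intro a c x
    simp only [hgs _ _ x]
    exact hstep a c x
  have htot : ∑ a, ∑ c, (D * ∑ v, g v a c) * Δ = D * Δ * G := by
    rw [hG]
    simp only [Finset.mul_sum]
    refine Finset.sum_congr rfl fun a _ => Finset.sum_congr rfl fun c _ => ?_
    rw [Finset.sum_mul]
    exact Finset.sum_congr rfl fun v _ => by ring
  have T1 : ∑ a, ∑ b, ∑ c, ∑ d, (∑ v, g v a c * g v c b) * (∑ w, g w a d) ≤ D * Δ * G := by
    rw [← htot]
    refine Finset.sum_le_sum fun a _ => ?_
    rw [Finset.sum_comm]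
    refine Finset.sum_le_sum fun c _ => ?_
    simp only [← Finset.mul_sum, ← Finset.sum_mul]
    exact mul_le_mul (hstep a c c) (hΔ a) (Finset.sum_nonneg fun b _ => hs0 a b)
      (mul_nonneg hD0 (hs0 _ _))
  have T2 : ∑ a, ∑ b, ∑ c, ∑ d, (∑ v, g v a c * g v a d) * (∑ w, g w c b) ≤ D * Δ * G := by
    rw [← htot]
    refine Finset.sum_le_sum fun a _ => ?_
    rw [Finset.sum_comm]
    refine Finset.sum_le_sum fun c _ => ?_
    simp only [← Finset.mul_sum, ← Finset.sum_mul]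
    exact mul_le_mul (hstep a c a) (hΔ c) (Finset.sum_nonneg fun b _ => hs0 c b)
      (mul_nonneg hD0 (hs0 _ _))
  have T3 : ∑ a, ∑ b, ∑ c, ∑ d, (∑ v, g v a c * g v d b) * (∑ w, g w c b) ≤ D * Δ * G := by
    rw [← htot]
    refine Finset.sum_le_sum fun a _ => ?_
    rw [Finset.sum_comm]
    refine Finset.sum_le_sum fun c _ => ?_
    simp only [← Finset.sum_mul]
    refine (Finset.sum_le_sum fun b _ =>
      mul_le_mul_of_nonneg_right (hstep' a c b) (hs0 c b)).trans ?_
    rw [← Finset.mul_sum]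
    exact mul_le_mul_of_nonneg_left (hΔ c) (mul_nonneg hD0 (hs0 _ _))
  refine (Finset.sum_le_sum fun a _ => Finset.sum_le_sum fun b _ => Finset.sum_le_sum fun c _ =>
    Finset.sum_le_sum fun d _ => hwick a b c d).trans ?_
  simp only [Finset.sum_add_distrib]
  linarith

end

/-! ### From semidefinite matrices to cuts -/

section

variable {V : Type*} [Fintype V] {h : V → V → V → ℝ}

/-- The adjacency matrix of the multigraph that the vertices of colour `2` induce on the remaining
vertices. -/
noncomputable def linkMatrix (h : V → V → V → ℝ) (f : V → Fin 3) : Matrix V V ℝ := fun a b =>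
  (1 - twoInd (f a)) * (1 - twoInd (f b)) * ∑ v, twoInd (f v) * h v a b

/-- The number of edges with one vertex of each colour. -/
noncomputable def rainbowCount (h : V → V → V → ℝ) (f : V → Fin 3) : ℝ :=
  ∑ v, ∑ a, ∑ b, h v a b * ((if f v = 2 then 1 else 0) * (if f a = 0 then 1 else 0) *
    (if f b = 1 then 1 else 0))

theorem twoInd_nonneg (c : Fin 3) : 0 ≤ twoInd c := by
  unfold twoInd
  split_ifs <;> simp

theorem one_sub_twoInd_nonneg (c : Fin 3) : 0 ≤ 1 - twoInd c := by
  unfold twoInd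
  split_ifs <;> simp

theorem linkMatrix_nonneg (hh : IsTripleSystem h) (f : V → Fin 3) (a b : V) :
    0 ≤ linkMatrix h f a b :=
  mul_nonneg (mul_nonneg (one_sub_twoInd_nonneg _) (one_sub_twoInd_nonneg _))
    (Finset.sum_nonneg fun _ _ => mul_nonneg (twoInd_nonneg _) (hh.nonneg _ _ _))

theorem linkMatrix_symm (hh : IsTripleSystem h) (f : V → Fin 3) (a b : V) :
    linkMatrix h f a b = linkMatrix h f b a := by
  simp only [linkMatrix, hh.swap_right _ a b]
  ring

theorem linkMatrix_diag (hh : IsTripleSystem h) (f : V → Fin 3) (a : V) :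
    linkMatrix h f a a = 0 := by
  simp [linkMatrix, hh.diag]

/-- Splitting the vertices that do not have colour `2` according to signs `x`. -/
theorem exists_rainbowCount_eq (hh : IsTripleSystem h) (f : V → Fin 3) (x : V → ℝ)
    (hx : ∀ i, x i = 1 ∨ x i = -1) :
    ∃ f' : V → Fin 3, rainbowCount h f' =
      (∑ a, ∑ b, linkMatrix h f a b - ∑ a, ∑ b, linkMatrix h f a b * (x a * x b)) / 4 := by
  refine ⟨fun v => if f v = 2 then 2 else if x v = 1 then 0 else 1, ?_⟩
  have h1 : ∀ v, (if (if f v = 2 then (2 : Fin 3) else if x v = 1 then 0 else 1) = 2 then (1 : ℝ)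
      else 0) = twoInd (f v) := by
    intro v
    unfold twoInd
    split_ifs <;> simp_all
  have h2 : ∀ v, (if (if f v = 2 then (2 : Fin 3) else if x v = 1 then 0 else 1) = 0 then (1 : ℝ)
      else 0) = (1 - twoInd (f v)) * ((1 + x v) / 2) := by
    intro v
    unfold twoInd
    by_cases e2 : f v = 2
    · simp [e2]
    · rcases hx v with e | e <;> norm_num [e2, e]
  have h3 : ∀ v, (if (if f v = 2 then (2 : Fin 3) else if x v = 1 then 0 else 1) = 1 then (1 : ℝ)
      else 0) = (1 - twoInd (f v)) * ((1 - x v) / 2) := by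
    intro v
    unfold twoInd
    by_cases e2 : f v = 2
    · simp [e2]
    · rcases hx v with e | e <;> norm_num [e2, e]
  simp only [rainbowCount, h1, h2, h3]
  have h4 : ∑ v, ∑ a, ∑ b, h v a b * (twoInd (f v) * ((1 - twoInd (f a)) * ((1 + x a) / 2)) *
      ((1 - twoInd (f b)) * ((1 - x b) / 2))) =
      ∑ a, ∑ b, linkMatrix h f a b * ((1 + x a) * (1 - x b) / 4) := by
    rw [Finset.sum_comm]
    refine Finset.sum_congr rfl fun a _ => ?_
    rw [Finset.sum_comm]
    refine Finset.sum_congr rfl fun b _ => ?_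
    rw [linkMatrix, Finset.mul_sum, Finset.sum_mul]
    exact Finset.sum_congr rfl fun v _ => by ring
  have h5 : ∑ a, ∑ b, linkMatrix h f a b * x a = ∑ a, ∑ b, linkMatrix h f a b * x b := by
    rw [Finset.sum_comm]
    exact Finset.sum_congr rfl fun a _ => Finset.sum_congr rfl fun b _ => by
      rw [linkMatrix_symm hh]
  have h6 : ∀ a b, linkMatrix h f a b * ((1 + x a) * (1 - x b) / 4) =
      linkMatrix h f a b / 4 + linkMatrix h f a b * x a / 4 - linkMatrix h f a b * x b / 4 -
        linkMatrix h f a b * (x a * x b) / 4 := by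
    intro a b
    ring
  rw [h4]
  simp only [h6, Finset.sum_add_distrib, Finset.sum_sub_distrib, ← Finset.sum_div]
  rw [h5]
  ring

variable [DecidableEq V]

/-- `4/27` is the probability that `v` has colour `2` and `a` and `b` have not. -/
theorem expect_linkMatrix (hh : IsTripleSystem h) (a b : V) :
    𝔼 f, linkMatrix h f a b = 4 / 27 * ∑ v, h v a b := by
  simp only [linkMatrix, Finset.mul_sum, Finset.expect_sum_comm]
  refine Finset.sum_congr rfl fun v _ => ?_
  by_cases h0 : h v a b = 0
  · simp [h0]
  · obtain ⟨hva, hvb, hab⟩ := hh.distinct h0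
    have h4 : ∀ f : V → Fin 3, (1 - twoInd (f a)) * (1 - twoInd (f b)) *
        (twoInd (f v) * h v a b) =
        (h v a b) * (twoInd (f v) * (1 - twoInd (f a)) * (1 - twoInd (f b))) := by
      intro f
      ring
    simp only [h4, ← Finset.mul_expect]
    rw [expect_three_mul hva hvb hab twoInd (fun c => 1 - twoInd c) (fun c => 1 - twoInd c)]
    have e1 : 𝔼 c, twoInd c = 1 / 3 := by
      rw [Fintype.expect_eq_sum_div_card]
      simp [twoInd]
    have e2 : 𝔼 c, (1 - twoInd c) = 2 / 3 := by
      rw [Fintype.expect_eq_sum_div_card]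
      simp [twoInd]
      norm_num
    rw [e1, e2]
    ring

/-- Every choice of semidefinite matrices `X f` with diagonal at most one, one for each colouring
`f`, gives a lower bound for the largest 3-cut. -/
theorem exists_rainbowCount_ge (hh : IsTripleSystem h) (X : (V → Fin 3) → Matrix V V ℝ)
    (hX : ∀ f, (X f).PosSemidef) (hX1 : ∀ f i, X f i i ≤ 1) {τ : ℝ} (hτ : 0 < τ) :
    ∃ f', (∑ a, ∑ b, ∑ v, h v a b) / 27 -
      (𝔼 f, ∑ a, ∑ b, linkMatrix h f a b * X f a b) / (4 * τ ^ 2) -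
      Real.exp (-τ ^ 2 / 4) / τ ^ 3 * (∑ a, ∑ b, ∑ v, h v a b) ≤ rainbowCount h f' := by
  set N := ∑ a, ∑ b, ∑ v, h v a b with hN
  have hN0 : 0 ≤ N := Finset.sum_nonneg fun a _ => Finset.sum_nonneg fun b _ =>
    Finset.sum_nonneg fun v _ => hh.nonneg _ _ _
  have hsum : 𝔼 f, ∑ a, ∑ b, linkMatrix h f a b = 4 / 27 * N := by
    simp only [Finset.expect_sum_comm, expect_linkMatrix hh, hN, Finset.mul_sum]
  set E := Real.exp (-τ ^ 2 / 4) with hE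
  have havg : N / 27 - (𝔼 f, ∑ a, ∑ b, linkMatrix h f a b * X f a b) / (4 * τ ^ 2) -
      E / τ ^ 3 * N ≤ 𝔼 f, ((∑ a, ∑ b, linkMatrix h f a b -
        (∑ a, ∑ b, linkMatrix h f a b * X f a b + 4 / τ * E *
          ∑ a, ∑ b, linkMatrix h f a b) / τ ^ 2) / 4) := by
    rw [← Finset.expect_div, Finset.expect_sub_distrib, ← Finset.expect_div,
      Finset.expect_add_distrib, ← Finset.mul_expect, hsum]
    have hE0 : 0 ≤ E / τ ^ 3 * N := by positivity
    have e : (4 / 27 * N - (𝔼 f, ∑ a, ∑ b, linkMatrix h f a b * X f a b +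
        4 / τ * E * (4 / 27 * N)) / τ ^ 2) / 4 =
        N / 27 - (𝔼 f, ∑ a, ∑ b, linkMatrix h f a b * X f a b) / (4 * τ ^ 2) -
          4 / 27 * (E / τ ^ 3 * N) := by
      field_simp
      ring
    rw [e]
    linarith
  obtain ⟨f, -, hf⟩ := Finset.exists_le_of_le_expect Finset.univ_nonempty havg
  obtain ⟨x, hx, hxA⟩ := exists_sign_le_of_posSemidef (linkMatrix h f) (X f)
    (linkMatrix_diag hh f) (linkMatrix_nonneg hh f) (hX f) (hX1 f) hτ
  obtain ⟨f', hf'⟩ := exists_rainbowCount_eq hh f x hx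
  refine ⟨f', hf.trans ?_⟩
  rw [hf']
  linarith

end

/-! ### Semidefinite matrices correlated with the link matrices -/

theorem posSemidef_of_sum_nonneg {V : Type*} [Fintype V] {M : Matrix V V ℝ}
    (hM : ∀ a b, M a b = M b a) (h0 : ∀ x : V → ℝ, 0 ≤ ∑ a, ∑ b, M a b * (x a * x b)) :
    M.PosSemidef := by
  refine Matrix.PosSemidef.of_dotProduct_mulVec_nonneg ?_ fun x => ?_
  · ext a b
    simp [hM a b]
  · refine (h0 x).trans (le_of_eq ?_)
    simp only [dotProduct, Matrix.mulVec, Finset.mul_sum, star_trivial]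
    exact Finset.sum_congr rfl fun a _ => Finset.sum_congr rfl fun b _ => by ring

section

variable {V : Type*} [Fintype V] {h g : V → V → V → ℝ}

/-- The codegree matrix of the 3-graph. -/
def codegree (h : V → V → V → ℝ) : Matrix V V ℝ := fun a b => ∑ v, h v a b

theorem codegree_symm (hh : IsTripleSystem h) (a b : V) : codegree h a b = codegree h b a :=
  Finset.sum_congr rfl fun _ _ => hh.swap_right _ _ _

theorem codegree_nonneg (hh : IsTripleSystem h) (a b : V) : 0 ≤ codegree h a b :=
  Finset.sum_nonneg fun _ _ => hh.nonneg _ _ _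

theorem codegree_diag (hh : IsTripleSystem h) (a : V) : codegree h a a = 0 := by
  simp [codegree, hh.diag]

variable [DecidableEq V]

theorem sum_one_mul (x : V → V → ℝ) :
    ∑ a, ∑ b, (1 : Matrix V V ℝ) a b * x a b = ∑ a, x a a := by
  simp [Matrix.one_apply]

theorem expect_sum_linkMatrix_mul (hh : IsTripleSystem h) (X : Matrix V V ℝ) :
    𝔼 f, ∑ a, ∑ b, linkMatrix h f a b * X a b = 4 / 27 * ∑ a, ∑ b, codegree h a b * X a b := by
  simp only [Finset.expect_sum_comm, ← Finset.expect_mul, expect_linkMatrix hh]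
  rw [Finset.mul_sum]
  refine Finset.sum_congr rfl fun a _ => ?_
  rw [Finset.mul_sum]
  exact Finset.sum_congr rfl fun b _ => mul_assoc _ _ _

/-- The semidefinite matrix `(1 - B / ‖B‖) / 2`, with the Frobenius norm of a symmetric matrix `B`
with zero diagonal. -/
theorem exists_posSemidef_frobenius {B : Matrix V V ℝ} (hB : ∀ a b, B a b = B b a)
    (hB0 : ∀ a, B a a = 0) (hpos : 0 < ∑ a, ∑ b, B a b ^ 2) :
    ∃ X : Matrix V V ℝ, X.PosSemidef ∧ (∀ i, X i i ≤ 1) ∧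
      ∑ a, ∑ b, B a b * X a b = -(√(∑ a, ∑ b, B a b ^ 2) / 2) := by
  set F := √(∑ a, ∑ b, B a b ^ 2) with hF
  have hF0 : 0 < F := Real.sqrt_pos.2 hpos
  have hFsq : F ^ 2 = ∑ a, ∑ b, B a b ^ 2 := Real.sq_sqrt hpos.le
  refine ⟨fun a b => ((1 : Matrix V V ℝ) a b - B a b / F) / 2,
    posSemidef_of_sum_nonneg (fun a b => ?_) fun x => ?_, fun i => ?_, ?_⟩
  · rw [hB a b, Matrix.one_apply, Matrix.one_apply]
    simp [eq_comm]
  · have h1 : ∀ a b, ((1 : Matrix V V ℝ) a b - B a b / F) / 2 * (x a * x b) =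
        ((1 : Matrix V V ℝ) a b * (x a * x b) - B a b * (x a * x b) / F) / 2 := by
      intro a b
      ring
    have h2 : ∑ a, ∑ b, B a b * (x a * x b) ≤ F * ∑ a, x a * x a := by
      have hx0 : 0 ≤ ∑ a, x a * x a := Finset.sum_nonneg fun a _ => mul_self_nonneg _
      refine le_of_sq_le_sq ?_ (by positivity)
      have hcs := Finset.sum_mul_sq_le_sq_mul_sq (Finset.univ : Finset (V × V))
        (fun p => B p.1 p.2) (fun p => x p.1 * x p.2)
      simp only [Fintype.sum_prod_type] at hcs
      rw [mul_pow, hFsq]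
      refine hcs.trans (le_of_eq ?_)
      congr 1
      rw [sq, Finset.sum_mul_sum]
      exact Finset.sum_congr rfl fun a _ => Finset.sum_congr rfl fun b _ => by ring
    simp only [h1, ← Finset.sum_div, Finset.sum_sub_distrib, sum_one_mul fun a b => x a * x b]
    have h3 : (∑ a, ∑ b, B a b * (x a * x b)) / F ≤ ∑ a, x a * x a := by
      rw [div_le_iff₀ hF0]
      linarith
    linarith
  · simp only [Matrix.one_apply_eq, hB0]
    norm_num
  · have h1 : ∀ a b, B a b * (((1 : Matrix V V ℝ) a b - B a b / F) / 2) =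
        ((1 : Matrix V V ℝ) a b * B a b - B a b ^ 2 / F) / 2 := by
      intro a b
      ring
    simp only [h1, ← Finset.sum_div, Finset.sum_sub_distrib, sum_one_mul fun a b => B a b, hB0,
      ← hFsq]
    field_simp
    simp

/-- The orthogonal projection to the complement of the indicator vector of `S`. -/
theorem exists_posSemidef_indicator (B : Matrix V V ℝ) (hB0 : ∀ a, B a a = 0) {S : Finset V}
    (hS : S.Nonempty) :
    ∃ X : Matrix V V ℝ, X.PosSemidef ∧ (∀ i, X i i ≤ 1) ∧
      ∑ a, ∑ b, B a b * X a b = -((∑ a ∈ S, ∑ b ∈ S, B a b) / S.card) := by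
  have hc : (0 : ℝ) < S.card := by exact_mod_cast hS.card_pos
  refine ⟨fun a b => (1 : Matrix V V ℝ) a b -
    (if a ∈ S then 1 else 0) * (if b ∈ S then 1 else 0) / S.card,
    posSemidef_of_sum_nonneg (fun a b => ?_) fun x => ?_, fun i => ?_, ?_⟩
  · rw [Matrix.one_apply, Matrix.one_apply, mul_comm (if a ∈ S then (1 : ℝ) else 0)]
    simp only [eq_comm]
  · have h1 : ∀ a b, ((1 : Matrix V V ℝ) a b -
        (if a ∈ S then 1 else 0) * (if b ∈ S then 1 else 0) / S.card) * (x a * x b) =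
        (1 : Matrix V V ℝ) a b * (x a * x b) -
          (if a ∈ S then x a else 0) * (if b ∈ S then x b else 0) / S.card := by
      intro a b
      split_ifs <;> ring
    simp only [h1, ← Finset.sum_div, Finset.sum_sub_distrib, sum_one_mul fun a b => x a * x b,
      ← Finset.sum_mul_sum]
    simp only [Finset.sum_ite_mem, Finset.univ_inter]
    have h2 := sq_sum_le_card_mul_sum_sq (s := S) (f := x)
    have h3 : ∑ a ∈ S, x a ^ 2 ≤ ∑ a, x a ^ 2 :=
      Finset.sum_le_sum_of_subset_of_nonneg (Finset.subset_univ S) fun _ _ _ => sq_nonneg _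
    have h4 : (∑ a ∈ S, x a) * (∑ a ∈ S, x a) / S.card ≤ ∑ a, x a ^ 2 := by
      rw [div_le_iff₀ hc]
      nlinarith
    simp only [sq] at h4
    linarith
  · beta_reduce
    rw [Matrix.one_apply_eq]
    have : (0 : ℝ) ≤ (if i ∈ S then 1 else 0) * (if i ∈ S then 1 else 0) / S.card := by
      split_ifs <;> positivity
    linarith
  · have h1 : ∀ a b, B a b * ((1 : Matrix V V ℝ) a b -
        (if a ∈ S then 1 else 0) * (if b ∈ S then 1 else 0) / S.card) =
        (1 : Matrix V V ℝ) a b * B a b - (if a ∈ S then if b ∈ S then B a b else 0 else 0) /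
          S.card := by
      intro a b
      split_ifs <;> ring
    simp only [h1, ← Finset.sum_div, Finset.sum_sub_distrib, sum_one_mul fun a b => B a b, hB0]
    have h2 : ∀ a, ∑ b, (if a ∈ S then if b ∈ S then B a b else 0 else 0) =
        if a ∈ S then ∑ b ∈ S, B a b else 0 := by
      intro a
      split_ifs <;> simp [Finset.sum_ite_mem]
    simp only [h2, Finset.sum_ite_mem, Finset.univ_inter]
    simp

theorem expect_comp_colorSwap (F : (V → Fin 3) → ℝ) :
    𝔼 f : V → Fin 3, F (fun i => colorSwap (f i)) = 𝔼 f, F f := by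
  have hinv : Function.Involutive fun (f : V → Fin 3) i => colorSwap (f i) := by
    intro f
    ext i
    simp [colorSwap_involutive (f i)]
  exact Fintype.expect_equiv (hinv.toPerm _) (fun f => F fun i => colorSwap (f i)) F fun f => rfl

/-- The semidefinite matrices `(1 - Z f) / 2`, restricted to the vertices of colour `0`, where `Z f`
is a cutoff of the signed link matrix of `g` at height `K`. As `Z` is odd under the exchange of the
colours `1` and `2`, only the signed part of the link matrix correlates with it. -/
theorem exists_posSemidef_random (hh : IsTripleSystem h) (hg0 : ∀ v a b, 0 ≤ g v a b)
    (hgh : ∀ v a b, h v a b * g v a b = g v a b) (hg1 : ∀ v a b, g v a b ≤ h v a b)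
    (hgs : ∀ v a b, g v a b = g v b a) {D Δ K θ : ℝ} (hD0 : 0 ≤ D)
    (hD : ∀ v b, ∑ d, g v b d ≤ D) (hΔ : ∀ a, ∑ b, ∑ w, g w a b ≤ Δ) (hK : 0 < K) (hθ : 0 < θ) :
    ∃ X : (V → Fin 3) → Matrix V V ℝ, (∀ f, (X f).PosSemidef) ∧ (∀ f i, X f i i ≤ 1) ∧
      𝔼 f, ∑ a, ∑ b, linkMatrix h f a b * X f a b ≤
        -((4 / 27 * (∑ a, ∑ b, ∑ v, g v a b) / K - θ / 27 * (∑ a, ∑ b, ∑ v, h v a b) -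
          3 * (D * Δ * ∑ a, ∑ b, ∑ v, g v a b) / (2 * θ * K ^ 4)) / 4) := by
  set Z : (V → Fin 3) → Matrix V V ℝ := fun f => oddCutoff (K⁻¹ • signedLink g f) with hZ
  have hherm : ∀ f, (K⁻¹ • signedLink g f).IsHermitian := by
    intro f
    have := (signedLink_isHermitian hgs f).eq
    rw [Matrix.IsHermitian, Matrix.conjTranspose_smul, this, star_trivial]
  have hZswap : ∀ f : V → Fin 3, Z (fun i => colorSwap (f i)) = -Z f := by
    intro f
    simp only [hZ, signedLink_colorSwap, smul_neg, oddCutoff_neg]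
  have hps : ∀ f, (1 - Z f).PosSemidef := fun f => posSemidef_one_sub_oddCutoff (hherm f)
  have hdiag : ∀ f i, -1 ≤ Z f i i := by
    intro f i
    have h1 : (1 - oddCutoff (-(K⁻¹ • signedLink g f))).PosSemidef :=
      posSemidef_one_sub_oddCutoff (hherm f).neg
    have h2 := h1.diag_nonneg (i := i)
    rw [oddCutoff_neg] at h2
    simp only [Matrix.sub_apply, Matrix.one_apply_eq, Matrix.neg_apply] at h2
    simp only [hZ]
    linarith
  refine ⟨fun f a b => zeroInd (f a) * zeroInd (f b) * ((1 - Z f) a b) / 2,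
    fun f => posSemidef_of_sum_nonneg (fun a b => ?_) fun x => ?_, fun f i => ?_, ?_⟩
  · have h1 := (hps f).isHermitian.apply a b
    rw [star_trivial] at h1
    beta_reduce
    rw [h1]
    ring
  · have h1 := (hps f).dotProduct_mulVec_nonneg fun a => zeroInd (f a) * x a
    simp only [dotProduct, Matrix.mulVec, Finset.mul_sum, star_trivial] at h1
    have h2 : 0 ≤ (1 / 2 : ℝ) * ∑ a, ∑ b, zeroInd (f a) * x a *
      ((1 - Z f) a b * (zeroInd (f b) * x b)) := by linarith
    refine h2.trans (le_of_eq ?_)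
    simp only [Finset.mul_sum]
    exact Finset.sum_congr rfl fun a _ => Finset.sum_congr rfl fun b _ => by ring
  · have h1 := hdiag f i
    have h2 := (hps f).diag_nonneg (i := i)
    simp only [Matrix.sub_apply, Matrix.one_apply_eq] at h2 ⊢
    rw [zeroInd_mul_self]
    nlinarith [zeroInd_le_one (f i), zeroInd_nonneg (f i)]
  -- The mean part and the signed part of the link matrix.
  set R : (V → Fin 3) → Matrix V V ℝ := fun f a b =>
    zeroInd (f a) * zeroInd (f b) * ∑ v, (1 - zeroInd (f v)) * h v a b with hR
  have hsplit : ∀ f, ∑ a, ∑ b, linkMatrix h f a b *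
      (zeroInd (f a) * zeroInd (f b) * ((1 - Z f) a b) / 2) =
      -(1 / 4) * ∑ a, ∑ b, R f a b * Z f a b +
        -(1 / 4) * ∑ a, ∑ b, signedLink h f a b * Z f a b := by
    intro f
    simp only [Finset.mul_sum, ← Finset.sum_add_distrib]
    refine Finset.sum_congr rfl fun a _ => Finset.sum_congr rfl fun b _ => ?_
    have hz : ∀ c, (1 - twoInd c) * zeroInd c = zeroInd c := by
      intro c
      unfold twoInd zeroInd
      split_ifs <;> simp_all
    have ht : ∀ c, twoInd c = (1 - zeroInd c + colorSign c) / 2 := by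
      simp [Fin.forall_fin_succ, twoInd, zeroInd, colorSign]
    have hL : linkMatrix h f a b * (zeroInd (f a) * zeroInd (f b)) =
        (R f a b + signedLink h f a b) / 2 := by
      calc _ = ((1 - twoInd (f a)) * zeroInd (f a)) * ((1 - twoInd (f b)) * zeroInd (f b)) *
            ∑ v, twoInd (f v) * h v a b := by
            rw [linkMatrix]
            ring
        _ = _ := by
            rw [hz, hz, hR, signedLink, colorSum, ← mul_add, ← Finset.sum_add_distrib,
              mul_div_assoc, Finset.sum_div]
            congr 1
            refine Finset.sum_congr rfl fun v _ => ?_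
            rw [ht]
            ring
    by_cases hab : a = b
    · subst hab
      have e1 : R f a a = 0 := by simp [hR, hh.diag]
      have e2 : signedLink h f a a = 0 := by simp [signedLink, colorSum, hh.diag]
      rw [linkMatrix_diag hh, e1, e2]
      ring
    · rw [Matrix.sub_apply, Matrix.one_apply_ne hab]
      linear_combination (-(Z f a b) / 2) * hL
  have hR0 : 𝔼 f, ∑ a, ∑ b, R f a b * Z f a b = 0 := by
    have h1 := expect_comp_colorSwap fun f => ∑ a, ∑ b, R f a b * Z f a b
    have h2 : ∀ f : V → Fin 3, R (fun i => colorSwap (f i)) = R f := by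
      intro f
      ext a b
      simp only [hR, zeroInd_colorSwap]
    simp only [hZswap, h2, Matrix.neg_apply, mul_neg, Finset.sum_neg_distrib,
      Finset.expect_neg_distrib] at h1
    linarith
  have hmain : 𝔼 f, (2 / K * ∑ a, ∑ b, signedLink h f a b * signedLink g f a b -
      θ / 2 * ∑ a, ∑ b, signedLink h f a b * signedLink h f a b -
      (2 * θ * K ^ 4)⁻¹ * ∑ a, ∑ b, (signedLink g f * signedLink g f) a b ^ 2) ≤
      𝔼 f, ∑ a, ∑ b, signedLink h f a b * Z f a b := by
    refine Finset.expect_le_expect fun f _ => ?_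
    have h1 := sum_sub_oddCutoff_sq_le (hherm f)
    have h2 : ∑ a, ∑ b, ((K⁻¹ • signedLink g f) * (K⁻¹ • signedLink g f)) a b ^ 2 =
        (K ^ 4)⁻¹ * ∑ a, ∑ b, (signedLink g f * signedLink g f) a b ^ 2 := by
      simp only [Finset.mul_sum, smul_mul_assoc, mul_smul_comm, Matrix.smul_apply, smul_eq_mul]
      refine Finset.sum_congr rfl fun a _ => Finset.sum_congr rfl fun b _ => ?_
      field_simp
    rw [h2] at h1
    have h3 : ∑ a, ∑ b, (2 / K * (signedLink h f a b * signedLink g f a b) -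
        θ / 2 * (signedLink h f a b * signedLink h f a b) -
        (2 * θ)⁻¹ * (2 * (K⁻¹ • signedLink g f) a b - Z f a b) ^ 2) ≤
        ∑ a, ∑ b, signedLink h f a b * Z f a b := by
      refine Finset.sum_le_sum fun a _ => Finset.sum_le_sum fun b _ => ?_
      rw [Matrix.smul_apply, smul_eq_mul]
      set M := signedLink h f a b
      set W := 2 * (K⁻¹ * signedLink g f a b) - Z f a b with hW
      have e1 : 0 ≤ (2 * θ)⁻¹ * (θ * M - W) ^ 2 := by positivity
      have e2 : (2 * θ)⁻¹ * (θ * M - W) ^ 2 = θ / 2 * (M * M) - M * W + (2 * θ)⁻¹ * W ^ 2 := by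
        field_simp
        ring
      have e3 : M * W = 2 / K * (M * signedLink g f a b) - M * Z f a b := by
        rw [hW]
        ring
      linarith
    simp only [Finset.sum_sub_distrib, ← Finset.mul_sum] at h3
    have h4 := mul_le_mul_of_nonneg_left h1 (show 0 ≤ (2 * θ)⁻¹ by positivity)
    rw [← mul_assoc, ← mul_inv] at h4
    linarith
  have hgN : ∑ a, ∑ b, ∑ v, h v a b * g v a b = ∑ a, ∑ b, ∑ v, g v a b := by simp only [hgh]
  have hhN : ∑ a, ∑ b, ∑ v, h v a b * h v a b = ∑ a, ∑ b, ∑ v, h v a b := by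
    simp only [hh.mul_self]
  rw [Finset.expect_sub_distrib, Finset.expect_sub_distrib, ← Finset.mul_expect,
    ← Finset.mul_expect, ← Finset.mul_expect, expect_sum_signedLink_mul hh,
    expect_sum_signedLink_mul hh, hgN, hhN] at hmain
  have h4 := mul_le_mul_of_nonneg_left
    (expect_sum_signedLink_sq_sq_le hg0 (fun v a b => (hg1 v a b).trans (hh.le_one v a b)) hgs hD0
      hD hΔ) (show 0 ≤ (2 * θ * K ^ 4)⁻¹ by positivity)
  simp only [hsplit, Finset.expect_add_distrib, ← Finset.mul_expect, hR0]
  have e1 : 2 / K * (2 / 27 * ∑ a, ∑ b, ∑ v, g v a b) =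
      4 / 27 * (∑ a, ∑ b, ∑ v, g v a b) / K := by ring
  have e2 : θ / 2 * (2 / 27 * ∑ a, ∑ b, ∑ v, h v a b) =
      θ / 27 * ∑ a, ∑ b, ∑ v, h v a b := by ring
  have e3 : (2 * θ * K ^ 4)⁻¹ * (3 * (D * Δ * ∑ a, ∑ b, ∑ v, g v a b)) =
      3 * (D * Δ * ∑ a, ∑ b, ∑ v, g v a b) / (2 * θ * K ^ 4) := by ring
  rw [e1, e2] at hmain
  rw [e3] at h4
  linarith

end

/-! ### Edges by codegree and degree -/

section

variable {V : Type*} [Fintype V] {h : V → V → V → ℝ}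

theorem sum_rotate (F : V → V → V → ℝ) :
    ∑ a, ∑ b, ∑ v, F a b v = ∑ a, ∑ b, ∑ v, F v a b :=
  ((Finset.sum_congr rfl fun _ _ => Finset.sum_comm).trans Finset.sum_comm).symm

/-- Twice the degree of a vertex. -/
def doubleDegree (h : V → V → V → ℝ) (a : V) : ℝ := ∑ b, codegree h a b

open Classical in
/-- The triples `(v, a, b)` for which `a` and `b` have degree at most `s³ / 2` and codegree at most
`s` with `v`. -/
noncomputable def lowTriple (h : V → V → V → ℝ) (s : ℝ) (v a b : V) : ℝ :=
  if doubleDegree h a ≤ s ^ 3 ∧ doubleDegree h b ≤ s ^ 3 ∧ codegree h v a ≤ s ∧ codegree h v b ≤ s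
  then h v a b else 0

open Classical in
/-- The triples `(v, a, b)` for which `a` and `b` have codegree more than `s`. -/
noncomputable def highCodegreeTriple (h : V → V → V → ℝ) (s : ℝ) (v a b : V) : ℝ :=
  if s < codegree h a b then h v a b else 0

open Classical in
/-- The triples `(v, a, b)` for which `a` and `b` have degree more than `s³ / 2`. -/
noncomputable def highDegreeTriple (h : V → V → V → ℝ) (s : ℝ) (v a b : V) : ℝ :=
  if s ^ 3 < doubleDegree h a ∧ s ^ 3 < doubleDegree h b then h v a b else 0

theorem lowTriple_nonneg (hh : IsTripleSystem h) (s : ℝ) (v a b : V) : 0 ≤ lowTriple h s v a b := by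
  unfold lowTriple
  split_ifs
  exacts [hh.nonneg _ _ _, le_rfl]

theorem highCodegreeTriple_nonneg (hh : IsTripleSystem h) (s : ℝ) (v a b : V) :
    0 ≤ highCodegreeTriple h s v a b := by
  unfold highCodegreeTriple
  split_ifs
  exacts [hh.nonneg _ _ _, le_rfl]

theorem highDegreeTriple_nonneg (hh : IsTripleSystem h) (s : ℝ) (v a b : V) :
    0 ≤ highDegreeTriple h s v a b := by
  unfold highDegreeTriple
  split_ifs
  exacts [hh.nonneg _ _ _, le_rfl]

/-- If all pairs of an edge have low codegree and at most one of its vertices has high degree, then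
some cyclic rotation of it is a low triple. -/
theorem sum_triple_le (hh : IsTripleSystem h) (s : ℝ) :
    ∑ a, ∑ b, ∑ v, h v a b ≤ 3 * (∑ a, ∑ b, ∑ v, lowTriple h s v a b +
      ∑ a, ∑ b, ∑ v, highCodegreeTriple h s v a b +
      ∑ a, ∑ b, ∑ v, highDegreeTriple h s v a b) := by
  set F : V → V → V → ℝ := fun v a b => lowTriple h s v a b + highCodegreeTriple h s v a b +
    highDegreeTriple h s v a b with hF
  have hF0 : ∀ v a b, 0 ≤ F v a b := fun v a b =>
    add_nonneg (add_nonneg (lowTriple_nonneg hh _ _ _ _) (highCodegreeTriple_nonneg hh _ _ _ _))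
      (highDegreeTriple_nonneg hh _ _ _ _)
  have hpt : ∀ v a b, h v a b ≤ F v a b + F a b v + F b v a := by
    intro v a b
    rcases hh.zero_or_one v a b with h0 | h1
    · rw [h0]
      linarith [hF0 v a b, hF0 a b v, hF0 b v a]
    have h2 : h a b v = 1 := by rw [← hh.rotate, h1]
    have h3 : h b v a = 1 := by rw [← hh.rotate, h2]
    have hc : ∀ x y z : V, h x y z = 1 → s < codegree h y z → 1 ≤ F x y z := by
      intro x y z hx hs
      have : highCodegreeTriple h s x y z = 1 := by rw [highCodegreeTriple, if_pos hs, hx]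
      simp only [hF, this]
      linarith [lowTriple_nonneg hh s x y z, highDegreeTriple_nonneg hh s x y z]
    have hd : ∀ x y z : V, h x y z = 1 → s ^ 3 < doubleDegree h y → s ^ 3 < doubleDegree h z →
        1 ≤ F x y z := by
      intro x y z hx hy hz
      have : highDegreeTriple h s x y z = 1 := by rw [highDegreeTriple, if_pos ⟨hy, hz⟩, hx]
      simp only [hF, this]
      linarith [lowTriple_nonneg hh s x y z, highCodegreeTriple_nonneg hh s x y z]
    have hl : ∀ x y z : V, h x y z = 1 → doubleDegree h y ≤ s ^ 3 → doubleDegree h z ≤ s ^ 3 →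
        codegree h x y ≤ s → codegree h x z ≤ s → 1 ≤ F x y z := by
      intro x y z hx hy hz h4 h5
      have : lowTriple h s x y z = 1 := by rw [lowTriple, if_pos ⟨hy, hz, h4, h5⟩, hx]
      simp only [hF, this]
      linarith [highDegreeTriple_nonneg hh s x y z, highCodegreeTriple_nonneg hh s x y z]
    rw [h1]
    suffices 1 ≤ F v a b ∨ 1 ≤ F a b v ∨ 1 ≤ F b v a by
      rcases this with h | h | h <;> linarith [hF0 v a b, hF0 a b v, hF0 b v a]
    rcases lt_or_ge s (codegree h a b) with c1 | c1
    · exact Or.inl (hc _ _ _ h1 c1)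
    rcases lt_or_ge s (codegree h b v) with c2 | c2
    · exact Or.inr (Or.inl (hc _ _ _ h2 c2))
    rcases lt_or_ge s (codegree h v a) with c3 | c3
    · exact Or.inr (Or.inr (hc _ _ _ h3 c3))
    have c1' := c1
    have c2' := c2
    have c3' := c3
    rw [codegree_symm hh] at c1' c2' c3'
    rcases lt_or_ge (s ^ 3) (doubleDegree h a) with d1 | d1 <;>
    rcases lt_or_ge (s ^ 3) (doubleDegree h b) with d2 | d2
    · exact Or.inl (hd _ _ _ h1 d1 d2)
    · rcases lt_or_ge (s ^ 3) (doubleDegree h v) with d3 | d3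
      · exact Or.inr (Or.inr (hd _ _ _ h3 d3 d1))
      · exact Or.inr (Or.inl (hl _ _ _ h2 d2 d3 c1 c3'))
    · rcases lt_or_ge (s ^ 3) (doubleDegree h v) with d3 | d3
      · exact Or.inr (Or.inl (hd _ _ _ h2 d2 d3))
      · exact Or.inr (Or.inr (hl _ _ _ h3 d3 d1 c2 c1'))
    · exact Or.inl (hl _ _ _ h1 d1 d2 c3 c2')
  have hsum : ∑ a, ∑ b, ∑ v, h v a b ≤ ∑ a, ∑ b, ∑ v, (F v a b + F a b v + F b v a) :=
    Finset.sum_le_sum fun a _ => Finset.sum_le_sum fun b _ => Finset.sum_le_sum fun v _ => hpt v a b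
  have e1 : ∑ a, ∑ b, ∑ v, F a b v = ∑ a, ∑ b, ∑ v, F v a b := sum_rotate F
  have e2 : ∑ a, ∑ b, ∑ v, F b v a = ∑ a, ∑ b, ∑ v, F a b v := sum_rotate fun x y z => F y z x
  simp only [Finset.sum_add_distrib] at hsum
  rw [e2, e1] at hsum
  simp only [hF, Finset.sum_add_distrib] at hsum
  linarith

variable [DecidableEq V]

/-- For a 3-graph with `s⁵` edges, some choice of semidefinite matrices has correlation of order
`-s³` with the link matrices. -/
theorem exists_posSemidef_family (hh : IsTripleSystem h) {s : ℝ} (hs : 0 < s)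
    (hN : ∑ a, ∑ b, ∑ v, h v a b = 6 * s ^ 5) :
    ∃ X : (V → Fin 3) → Matrix V V ℝ, (∀ f, (X f).PosSemidef) ∧ (∀ f i, X f i i ≤ 1) ∧
      𝔼 f, ∑ a, ∑ b, linkMatrix h f a b * X f a b ≤ -(s ^ 3 / 6561) := by
  classical
  have hs3 : 0 < s ^ 3 := by positivity
  have hs5 : 0 < s ^ 5 := by positivity
  have hcase := sum_triple_le hh s
  rw [hN] at hcase
  by_cases hP : 2 / 3 * s ^ 5 ≤ ∑ a, ∑ b, ∑ v, highCodegreeTriple h s v a b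
  · have hle : s * ∑ a, ∑ b, ∑ v, highCodegreeTriple h s v a b ≤
        ∑ a, ∑ b, codegree h a b ^ 2 := by
      simp only [Finset.mul_sum]
      refine Finset.sum_le_sum fun a _ => Finset.sum_le_sum fun b _ => ?_
      rw [← Finset.mul_sum]
      simp only [highCodegreeTriple]
      split_ifs with hab
      · have : ∑ v, h v a b = codegree h a b := rfl
        rw [this]
        nlinarith
      · simp [sq_nonneg]
    have hlow : (s ^ 3 / 2) ^ 2 ≤ ∑ a, ∑ b, codegree h a b ^ 2 := by
      refine le_trans ?_ hle
      have := mul_le_mul_of_nonneg_left hP hs.le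
      refine le_trans ?_ this
      have h6 : 0 < s ^ 6 := by positivity
      nlinarith
    obtain ⟨X, hX, hX1, hXs⟩ := exists_posSemidef_frobenius (codegree_symm hh) (codegree_diag hh)
      (lt_of_lt_of_le (by positivity) hlow)
    refine ⟨fun _ => X, fun _ => hX, fun _ => hX1, ?_⟩
    rw [expect_sum_linkMatrix_mul hh, hXs]
    have := Real.le_sqrt_of_sq_le hlow
    linarith
  by_cases hQ : 2 / 3 * s ^ 5 ≤ ∑ a, ∑ b, ∑ v, highDegreeTriple h s v a b
  · set S := Finset.univ.filter fun a => s ^ 3 < doubleDegree h a with hS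
    have hQS : ∑ a, ∑ b, ∑ v, highDegreeTriple h s v a b = ∑ a ∈ S, ∑ b ∈ S, codegree h a b := by
      simp only [hS, Finset.sum_filter]
      refine Finset.sum_congr rfl fun a _ => ?_
      by_cases ha : s ^ 3 < doubleDegree h a
      · rw [if_pos ha]
        refine Finset.sum_congr rfl fun b _ => ?_
        by_cases hb : s ^ 3 < doubleDegree h b <;> simp [highDegreeTriple, ha, hb, codegree]
      · rw [if_neg ha]
        simp [highDegreeTriple, ha]
    have hSne : S.Nonempty := by
      rw [Finset.nonempty_iff_ne_empty]
      intro h0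
      rw [hQS, h0] at hQ
      simp only [Finset.sum_empty] at hQ
      linarith
    have hc : (0 : ℝ) < S.card := by exact_mod_cast hSne.card_pos
    have hcard : S.card * s ^ 3 ≤ 6 * s ^ 5 := by
      have h1 : ∑ a ∈ S, s ^ 3 ≤ ∑ a ∈ S, doubleDegree h a :=
        Finset.sum_le_sum fun a ha => (Finset.mem_filter.1 ha).2.le
      have h2 : ∑ a ∈ S, doubleDegree h a ≤ ∑ a, doubleDegree h a :=
        Finset.sum_le_sum_of_subset_of_nonneg (Finset.subset_univ S) fun a _ _ =>
          Finset.sum_nonneg fun b _ => codegree_nonneg hh a b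
      have h3 : ∑ a, doubleDegree h a = 6 * s ^ 5 := hN
      rw [Finset.sum_const, nsmul_eq_mul] at h1
      linarith
    obtain ⟨X, hX, hX1, hXs⟩ := exists_posSemidef_indicator (codegree h) (codegree_diag hh) hSne
    refine ⟨fun _ => X, fun _ => hX, fun _ => hX1, ?_⟩
    rw [expect_sum_linkMatrix_mul hh, hXs, ← hQS]
    have : s ^ 3 / 9 ≤ (∑ a, ∑ b, ∑ v, highDegreeTriple h s v a b) / S.card := by
      rw [le_div_iff₀ hc]
      linarith
    linarith
  -- `K = 81 s² / 2` and `θ = 2 / (9 K)` balance the three terms in `exists_posSemidef_random`.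
  have hG : 2 / 3 * s ^ 5 ≤ ∑ a, ∑ b, ∑ v, lowTriple h s v a b := by
    push Not at hP hQ
    linarith
  have hlow_le : ∀ v a b, lowTriple h s v a b ≤ h v a b := by
    intro v a b
    unfold lowTriple
    split_ifs
    exacts [le_rfl, hh.nonneg _ _ _]
  have hcodeg : ∀ a b, ∑ d, h a b d = codegree h a b := fun a b =>
    Finset.sum_congr rfl fun d _ => by rw [hh.rotate, hh.rotate, hh.rotate]
  obtain ⟨X, hX, hX1, hXs⟩ := exists_posSemidef_random (g := lowTriple h s) (D := s) (Δ := s ^ 3)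
    (K := 81 / 2 * s ^ 2) (θ := 2 / 9 / (81 / 2 * s ^ 2)) hh (lowTriple_nonneg hh s)
    (fun v a b => by
      unfold lowTriple
      split_ifs
      · exact hh.mul_self v a b
      · exact mul_zero _)
    hlow_le
    (fun v a b => by
      unfold lowTriple
      rw [hh.swap_right v a b]
      refine if_congr ?_ rfl rfl
      tauto)
    hs.le
    (fun v b => by
      by_cases hvb : codegree h v b ≤ s
      · exact (Finset.sum_le_sum fun d _ => hlow_le v b d).trans ((hcodeg v b).trans_le hvb)
      · simp [lowTriple, hvb, hs.le])
    (fun a => by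
      by_cases ha : doubleDegree h a ≤ s ^ 3
      · exact (Finset.sum_le_sum fun b _ => Finset.sum_le_sum fun w _ => hlow_le w a b).trans ha
      · simp [lowTriple, ha, hs3.le])
    (by positivity) (by positivity)
  refine ⟨X, hX, hX1, hXs.trans ?_⟩
  rw [hN]
  set G := ∑ a, ∑ b, ∑ v, lowTriple h s v a b
  have hGN : G ≤ 6 * s ^ 5 := by
    rw [← hN]
    exact Finset.sum_le_sum fun a _ => Finset.sum_le_sum fun b _ => Finset.sum_le_sum fun v _ =>
      hlow_le v a b
  have e1 : 4 / 27 * (2 / 3 * s ^ 5) / (81 / 2 * s ^ 2) ≤ 4 / 27 * G / (81 / 2 * s ^ 2) := by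
    gcongr
  have e2 : 3 * (s * s ^ 3 * G) / (2 * (2 / 9 / (81 / 2 * s ^ 2)) * (81 / 2 * s ^ 2) ^ 4) ≤
      3 * (s * s ^ 3 * (6 * s ^ 5)) /
        (2 * (2 / 9 / (81 / 2 * s ^ 2)) * (81 / 2 * s ^ 2) ^ 4) := by
    gcongr
  have e3 : 4 / 27 * (2 / 3 * s ^ 5) / (81 / 2 * s ^ 2) -
      2 / 9 / (81 / 2 * s ^ 2) / 27 * (6 * s ^ 5) -
      3 * (s * s ^ 3 * (6 * s ^ 5)) /
        (2 * (2 / 9 / (81 / 2 * s ^ 2)) * (81 / 2 * s ^ 2) ^ 4) = 4 * (s ^ 3 / 6561) := by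
    field_simp
    norm_num
  linarith

/-- The bound for a 3-graph with `s⁵` edges and an arbitrary truncation level `τ`; choosing `τ` of
order `√(log s)` makes the last term negligible at the cost of a logarithm. -/
theorem exists_rainbowCount_ge_of_sum_eq (hh : IsTripleSystem h) {s τ : ℝ} (hs : 0 < s)
    (hτ : 0 < τ) (hN : ∑ a, ∑ b, ∑ v, h v a b = 6 * s ^ 5) :
    ∃ f, 2 / 9 * s ^ 5 + s ^ 3 / (26244 * τ ^ 2) - Real.exp (-τ ^ 2 / 4) / τ ^ 3 * (6 * s ^ 5) ≤
      rainbowCount h f := by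
  obtain ⟨X, hX, hX1, hXs⟩ := exists_posSemidef_family hh hs hN
  obtain ⟨f, hf⟩ := exists_rainbowCount_ge hh X hX hX1 hτ
  refine ⟨f, le_trans ?_ hf⟩
  rw [hN]
  have h1 : (𝔼 f, ∑ a, ∑ b, linkMatrix h f a b * X f a b) / (4 * τ ^ 2) ≤
      -(s ^ 3 / 6561) / (4 * τ ^ 2) := by gcongr
  have h2 : -(s ^ 3 / 6561) / (4 * τ ^ 2) = -(s ^ 3 / (26244 * τ ^ 2)) := by
    field_simp
    norm_num
  linarith

end

/-! ### From hypergraphs to indicator functions -/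

theorem triple_eq_triple_iff {α : Type*} {x y z : α} (hxy : x ≠ y) (hxz : x ≠ z) (hyz : y ≠ z)
    (v a b : α) :
    ({v, a, b} : Set α) = {x, y, z} ↔
      (v = x ∧ a = y ∧ b = z) ∨ (v = x ∧ a = z ∧ b = y) ∨ (v = y ∧ a = x ∧ b = z) ∨
      (v = y ∧ a = z ∧ b = x) ∨ (v = z ∧ a = x ∧ b = y) ∨ (v = z ∧ a = y ∧ b = x) := by
  constructor
  · intro h
    simp only [Set.ext_iff, Set.mem_insert_iff, Set.mem_singleton_iff] at h
    have hv := h v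
    have ha := h a
    have hb := h b
    have hx := h x
    have hy := h y
    have hz := h z
    clear h
    grind
  · rintro (⟨rfl, rfl, rfl⟩ | ⟨rfl, rfl, rfl⟩ | ⟨rfl, rfl, rfl⟩ | ⟨rfl, rfl, rfl⟩ |
      ⟨rfl, rfl, rfl⟩ | ⟨rfl, rfl, rfl⟩) <;>
    · ext t
      simp only [Set.mem_insert_iff, Set.mem_singleton_iff] <;> tauto

open Classical in
/-- The indicator function of the edges of a 3-graph on ordered triples of vertices. -/
noncomputable def edgeInd {α : Type*} (H : Hypergraph α) (v a b : H.vertexSet) : ℝ :=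
  if ({(v : α), (a : α), (b : α)} : Set α) ∈ H.edgeSet then 1 else 0

theorem isTripleSystem_edgeInd {α : Type*} {H : Hypergraph α} (hH : H.IsUniform 3) :
    IsTripleSystem (edgeInd H) where
  zero_or_one v a b := by
    unfold edgeInd
    split_ifs <;> simp
  swap_right v a b := by rw [edgeInd, edgeInd, Set.pair_comm]
  rotate v a b := by
    rw [edgeInd, edgeInd, Set.insert_comm (v : α), Set.pair_comm (v : α)]
  ne_of_ne_zero v a b h0 hva := by
    subst hva
    apply h0
    rw [edgeInd, if_neg]
    intro he
    have h3 := hH _ he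
    rw [Set.insert_eq_of_mem (Set.mem_insert _ _)] at h3
    have h2 := Set.encard_insert_le {(b : α)} (v : α)
    rw [h3, Set.encard_singleton] at h2
    exact absurd h2 (by norm_num)

open Classical in
theorem card_ordered_triples {α : Type*} {H : Hypergraph α} [Fintype H.vertexSet]
    (hfin : H.edgeSet.Finite) (hH : H.IsUniform 3) :
    (Finset.univ.filter fun p : H.vertexSet × H.vertexSet × H.vertexSet =>
      ({(p.1 : α), (p.2.1 : α), (p.2.2 : α)} : Set α) ∈ H.edgeSet).card =
      6 * H.edgeSet.ncard := by
  rw [Finset.card_eq_sum_card_fiberwise (t := hfin.toFinset)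
    (f := fun p => ({(p.1 : α), (p.2.1 : α), (p.2.2 : α)} : Set α)) (by
      intro p hp
      simpa using hp)]
  rw [Set.ncard_eq_toFinset_card _ hfin, mul_comm, ← smul_eq_mul, ← Finset.sum_const]
  refine Finset.sum_congr rfl fun e he => ?_
  rw [Set.Finite.mem_toFinset] at he
  obtain ⟨x, y, z, hxy, hxz, hyz, rfl⟩ := Set.encard_eq_three.1 (hH e he)
  have hsub : ({x, y, z} : Set α) ⊆ H.vertexSet := H.subset_vertexSet_of_mem_edgeSet he
  have hx : x ∈ H.vertexSet := hsub (by simp)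
  have hy : y ∈ H.vertexSet := hsub (by simp)
  have hz : z ∈ H.vertexSet := hsub (by simp)
  lift x to H.vertexSet using hx
  lift y to H.vertexSet using hy
  lift z to H.vertexSet using hz
  have hxy' : x ≠ y := fun h => hxy (congrArg _ h)
  have hxz' : x ≠ z := fun h => hxz (congrArg _ h)
  have hyz' : y ≠ z := fun h => hyz (congrArg _ h)
  have hset : ((Finset.univ.filter fun p : H.vertexSet × H.vertexSet × H.vertexSet =>
      ({(p.1 : α), (p.2.1 : α), (p.2.2 : α)} : Set α) ∈ H.edgeSet).filter fun p =>
      ({(p.1 : α), (p.2.1 : α), (p.2.2 : α)} : Set α) = {(x : α), (y : α), (z : α)}) =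
      {(x, y, z), (x, z, y), (y, x, z), (y, z, x), (z, x, y), (z, y, x)} := by
    ext ⟨v, a, b⟩
    simp only [Finset.mem_filter, Finset.mem_univ, true_and, Finset.mem_insert,
      Finset.mem_singleton, Prod.mk.injEq]
    have key := triple_eq_triple_iff hxy hxz hyz (v : α) (a : α) (b : α)
    simp only [Subtype.coe_inj] at key
    rw [← key]
    constructor
    · exact fun h => h.2
    · exact fun h => ⟨by rw [h]; exact he, h⟩
  rw [hset]
  simp [hxy', hxz', hyz', hxy'.symm, hxz'.symm, hyz'.symm]

theorem sum_edgeInd {α : Type*} {H : Hypergraph α} [Fintype H.vertexSet]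
    (hfin : H.edgeSet.Finite) (hH : H.IsUniform 3) :
    ∑ a, ∑ b, ∑ v, edgeInd H v a b = 6 * H.edgeSet.ncard := by
  classical
  rw [← sum_rotate, ← Nat.cast_ofNat, ← Nat.cast_mul, ← card_ordered_triples hfin hH,
    Finset.card_filter]
  simp only [Fintype.sum_prod_type, edgeInd, Nat.cast_sum, Nat.cast_ite, Nat.cast_one,
    Nat.cast_zero]

/-- The vertices of each colour. -/
def colorClass {α : Type*} (H : Hypergraph α) (f : H.vertexSet → Fin 3) (i : Fin 3) : Set α :=
  Subtype.val '' (f ⁻¹' {i})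

theorem isVertexPartition_colorClass {α : Type*} (H : Hypergraph α) (f : H.vertexSet → Fin 3) :
    H.IsVertexPartition (colorClass H f) := by
  constructor
  · intro i j hij
    rw [Set.disjoint_left]
    rintro _ ⟨x, hx, rfl⟩ ⟨y, hy, hxy⟩
    rw [Subtype.coe_inj] at hxy
    subst hxy
    exact hij (hx.symm.trans hy)
  · ext x
    simp [colorClass]

theorem rainbowCount_le_ncard_cutEdges {α : Type*} {H : Hypergraph α} [Fintype H.vertexSet]
    (hfin : H.edgeSet.Finite) (f : H.vertexSet → Fin 3) :
    rainbowCount (edgeInd H) f ≤ (H.cutEdges (colorClass H f)).ncard := by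
  classical
  set T := Finset.univ.filter fun p : H.vertexSet × H.vertexSet × H.vertexSet =>
    ({(p.1 : α), (p.2.1 : α), (p.2.2 : α)} : Set α) ∈ H.edgeSet ∧ f p.1 = 2 ∧ f p.2.1 = 0 ∧
      f p.2.2 = 1 with hT
  have hcount : rainbowCount (edgeInd H) f = T.card := by
    rw [hT, Finset.card_filter]
    simp only [Fintype.sum_prod_type, rainbowCount, edgeInd, Nat.cast_sum]
    refine Finset.sum_congr rfl fun v _ => Finset.sum_congr rfl fun a _ =>
      Finset.sum_congr rfl fun b _ => ?_
    split_ifs <;> simp_all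
  have hcutfin : (H.cutEdges (colorClass H f)).Finite := hfin.subset fun e he => he.1
  rw [hcount, ← Set.ncard_coe_finset, Nat.cast_le]
  refine Set.ncard_le_ncard_of_injOn
    (fun p => ({(p.1 : α), (p.2.1 : α), (p.2.2 : α)} : Set α)) ?_ ?_ hcutfin
  · rintro ⟨v, a, b⟩ hp
    simp only [hT, Finset.coe_filter, Finset.mem_univ, true_and, Set.mem_ofPred_eq] at hp
    obtain ⟨he, hv, ha, hb⟩ := hp
    refine ⟨he, fun i => ?_⟩
    fin_cases i
    · exact ⟨a, by simp, a, ha, rfl⟩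
    · exact ⟨b, by simp, b, hb, rfl⟩
    · exact ⟨v, by simp, v, hv, rfl⟩
  · rintro ⟨v, a, b⟩ hp ⟨v', a', b'⟩ hp' heq
    simp only [hT, Finset.coe_filter, Finset.mem_univ, true_and, Set.mem_ofPred_eq] at hp hp'
    obtain ⟨-, hv, ha, hb⟩ := hp
    obtain ⟨-, hv', ha', hb'⟩ := hp'
    simp only [Set.ext_iff, Set.mem_insert_iff, Set.mem_singleton_iff] at heq
    have h1 := (heq v).1 (by simp)
    have h2 := (heq a).1 (by simp)
    have h3 := (heq b).1 (by simp)
    simp only [Subtype.coe_inj] at h1 h2 h3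
    have e1 : v = v' := by
      rcases h1 with h | h | h
      · exact h
      · rw [h, ha'] at hv
        exact absurd hv (by decide)
      · rw [h, hb'] at hv
        exact absurd hv (by decide)
    have e2 : a = a' := by
      rcases h2 with h | h | h
      · rw [h, hv'] at ha
        exact absurd ha (by decide)
      · exact h
      · rw [h, hb'] at ha
        exact absurd ha (by decide)
    have e3 : b = b' := by
      rcases h3 with h | h | h
      · rw [h, hv'] at hb
        exact absurd hb (by decide)
      · rw [h, ha'] at hb
        exact absurd hb (by decide)
      · exact h
    rw [e1, e2, e3]

/-- With truncation level `τ = √(80 log m)` the error term is of order `m⁻¹⁹`, and the constants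
work for all `m ≥ 2`. -/
theorem surplus_le {m : ℕ} (hm : 2 ≤ m) :
    1 / 8398080 * ((m : ℝ) ^ (3 / 5 : ℝ) / Real.log m ^ 2) ≤
      ((m : ℝ) ^ (1 / 5 : ℝ)) ^ 3 / (26244 * √(80 * Real.log m) ^ 2) -
        Real.exp (-√(80 * Real.log m) ^ 2 / 4) / √(80 * Real.log m) ^ 3 *
          (6 * ((m : ℝ) ^ (1 / 5 : ℝ)) ^ 5) := by
  have hm2 : (2 : ℝ) ≤ m := by exact_mod_cast hm
  have hm0 : (0 : ℝ) < m := by linarith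
  set L := Real.log m with hL
  have hL2 : 1 / 2 ≤ L := by
    have h1 := Real.log_le_log (by norm_num) hm2
    have h2 := Real.log_two_gt_d9
    linarith
  have hL0 : 0 < L := by linarith
  set τ := √(80 * L) with hτ
  have hτ2 : τ ^ 2 = 80 * L := Real.sq_sqrt (by positivity)
  have hτ1 : 1 ≤ τ := by
    rw [hτ, Real.one_le_sqrt]
    linarith
  have e3 : ((m : ℝ) ^ (1 / 5 : ℝ)) ^ 3 = (m : ℝ) ^ (3 / 5 : ℝ) := by
    rw [← Real.rpow_natCast, ← Real.rpow_mul hm0.le]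
    norm_num
  have e5 : ((m : ℝ) ^ (1 / 5 : ℝ)) ^ 5 = m := by
    rw [← Real.rpow_natCast, ← Real.rpow_mul hm0.le]
    norm_num
  have hexp : Real.exp (-τ ^ 2 / 4) = ((m : ℝ) ^ 20)⁻¹ := by
    have : -τ ^ 2 / 4 = -((20 : ℕ) * L) := by
      rw [neg_div, hτ2]
      push_cast
      ring
    rw [this, Real.exp_neg, Real.exp_nat_mul, hL, Real.exp_log hm0]
  rw [e3, e5, hexp]
  set A := (m : ℝ) ^ (3 / 5 : ℝ) with hA
  have hA1 : 1 ≤ A := Real.one_le_rpow (by linarith) (by norm_num)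
  have hm19 : (2 : ℝ) ^ 19 ≤ (m : ℝ) ^ 19 := by gcongr
  have herr : ((m : ℝ) ^ 20)⁻¹ / τ ^ 3 * (6 * m) ≤ A / (52488 * τ ^ 2) := by
    have h1 : ((m : ℝ) ^ 20)⁻¹ / τ ^ 3 * (6 * m) = 6 / ((m : ℝ) ^ 19 * τ ^ 3) := by
      field_simp
    rw [h1, div_le_div_iff₀ (by positivity) (by positivity)]
    have h2 : 6 * (52488 : ℝ) ≤ A * (m : ℝ) ^ 19 * τ := by
      calc 6 * (52488 : ℝ) ≤ 1 * 2 ^ 19 * 1 := by norm_num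
        _ ≤ A * (m : ℝ) ^ 19 * τ := by gcongr
    calc 6 * (52488 * τ ^ 2) = (6 * 52488) * τ ^ 2 := by ring
      _ ≤ (A * (m : ℝ) ^ 19 * τ) * τ ^ 2 := by gcongr
      _ = A * ((m : ℝ) ^ 19 * τ ^ 3) := by ring
  have hmain : 1 / 8398080 * (A / L ^ 2) ≤ A / (52488 * τ ^ 2) := by
    rw [hτ2, one_div_mul_eq_div, div_div, div_le_div_iff₀ (by positivity) (by positivity)]
    have : L * (1 / 2) ≤ L * L := by gcongr
    nlinarith
  have hhalf : A / (26244 * τ ^ 2) = A / (52488 * τ ^ 2) + A / (52488 * τ ^ 2) := by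
    field_simp
    norm_num
  linarith

end HypergraphCut

theorem theorem1p1 :
    ∃ c : ℝ, 0 < c ∧
      ∀ (α : Type*) (H : Hypergraph α) (m : ℕ),
        H.vertexSet.Finite → H.IsUniform 3 → H.edgeSet.ncard = m → 2 ≤ m →
        ∃ P : Fin 3 → Set α, H.IsVertexPartition P ∧
          (2 / 9 : ℝ) * (m : ℝ) + c * ((m : ℝ) ^ (3 / 5 : ℝ) / (Real.log (m : ℝ)) ^ 2)
            ≤ ((H.cutEdges P).ncard : ℝ) := by
  classical
  refine ⟨1 / 8398080, by norm_num, fun α H m hV hH hE hm => ?_⟩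
  have : Fintype H.vertexSet := hV.fintype
  have hfin : H.edgeSet.Finite := hV.finite_subsets.subset fun e he =>
    H.subset_vertexSet_of_mem_edgeSet he
  have hm0 : (0 : ℝ) < m := by positivity
  have hlog : 0 < Real.log m := Real.log_pos (by exact_mod_cast hm)
  have h5 : ((m : ℝ) ^ (1 / 5 : ℝ)) ^ 5 = m := by
    rw [← Real.rpow_natCast, ← Real.rpow_mul hm0.le]
    norm_num
  obtain ⟨f, hf⟩ := HypergraphCut.exists_rainbowCount_ge_of_sum_eq
    (HypergraphCut.isTripleSystem_edgeInd hH) (s := (m : ℝ) ^ (1 / 5 : ℝ))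
    (τ := √(80 * Real.log m)) (by positivity) (by positivity)
    (by rw [HypergraphCut.sum_edgeInd hfin hH, hE, h5])
  refine ⟨HypergraphCut.colorClass H f, HypergraphCut.isVertexPartition_colorClass H f, ?_⟩
  have h1 := HypergraphCut.surplus_le hm
  have h2 := HypergraphCut.rainbowCount_le_ncard_cutEdges hfin f
  rw [h5] at hf h1
  linarith
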